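/- **Setting.** Let $V$ be a $C^\infty$ manifold of dimension $\bar n=n+m_1+\dots+m_z\ge 3$. In each chart of its atlas, with coordinates $u=(x^i,y^{a_1},\dots,y^{a_z})$, let there be given smooth coefficients $N_\alpha^{\ b}$ of a higher order N-connection (nonzero only if $b$ belongs to a higher shell than $\alpha$), the adapted frame $\delta_\alpha=\partial_\alpha-N_\alpha^{\ b}\partial_b$ with dual coframe $\delta u^\alpha$ and anholonomy coefficients $[\delta_\alpha,\delta_\beta]=w^\gamma_{\ \alpha\beta}\delta_\gamma$, a nondegenerate symmetric metric $g_{\alpha\beta}$ (components in the adapted frame) that is block diagonal with respect to the shells, and a linear connection $D_{\delta_\gamma}\delta_\beta=\Gamma^\alpha_{\ \beta\gamma}\delta_\alpha$ that preserves the splitting into horizontal ($i$) and vertical ($a$) vectors and satisfies $Dg=0$; torsion is allowed. On overlaps of charts the adapted frames are related by shell-block-diagonal matrices, and $g$ and $\Gamma$ transform as a tensor and a connection. Let $$R_{\beta\ \gamma\tau}^{\ \alpha}=\delta_\tau\Gamma^\alpha_{\ \beta\gamma}-\delta_\gamma\Gamma^\alpha_{\ \beta\tau}+\Gamma^\varphi_{\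 \beta\gamma}\Gamma^\alpha_{\ \varphi\tau}-\Gamma^\varphi_{\ \beta\tau}\Gamma^\alpha_{\ \varphi\gamma}+\Gamma^\alpha_{\ \beta\varphi}w^\varphi_{\ \gamma\tau},$$ and put $R_{ij}=R_{i\ jk}^{\ k}$ ($k$ horizontal), $S_{ab}=R_{a\ bc}^{\ c}$ ($c$ vertical), and, for $b$ in a lower shell than $a$, ${}^1P_{ab}=R_{a\ bc}^{\ c}$ ($c$ vertical) and ${}^2P_{ba}=R_{b\ ca}^{\ c}$ ($c$ horizontal or vertical according to $b$); $\hat R=g^{ij}R_{ij}$, $\bar S=g^{ab}S_{ab}$. Let $\Upsilon_{\alpha\beta}$ be a covariant rank two tensor field, $k,\lambda\in\mathbb R$, and $$E_{\alpha\beta}=k\Upsilon_{\alpha\beta}-\lambda g_{\alpha\beta},\qquad E=g^{\alpha\beta}E_{\alpha\beta}.$$ The *Einstein equations* are $$R_{ij}-\tfrac12(\hat R+\bar S)g_{ij}=E_{ij},\quad S_{ab}-\tfrac12(\hat R+\bar S)g_{ab}=E_{ab},\quad {}^1P_{ab}=E_{ab},\quad {}^2P_{ba}=-E_{ba},$$ the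 last two for $b$ in a lower shell than $a$ (horizontal $b$ included). **Cartan connection.** On an open region $W$ of a chart let $e^\alpha$ be an orthonormal adapted coframe, $g=\sum_\alpha\eta(\alpha)e^\alpha\otimes e^\alpha$, $\eta(\alpha)=\pm1$, with the Hodge operator $$*(e^{\mu_1}\wedge\dots\wedge e^{\mu_r})=\eta(\nu_1)\cdots\eta(\nu_{\bar n-r})\,\mathrm{sign}(\mu_1\dots\mu_r\nu_1\dots\nu_{\bar n-r})\,e^{\nu_1}\wedge\dots\wedge e^{\nu_{\bar n-r}},$$ $*^{-1}=\eta(1)\cdots\eta(\bar n)(-1)^{r(\bar n-r)}*$ and $\hat\delta=(-1)^r*^{-1}d*$ on $r$-forms. Let a local section of the bundle of adapted frames (frames obtained from $\delta_\alpha$ by smooth invertible shell-block-diagonal matrices) be given by its dual coframe $\chi^\alpha=\chi^\alpha_{\ \mu}\delta u^\mu$, and let $\omega$ be the connection form of $D$ in this frame. The induced Cartan connection in the bundle of adapted affine frames is $\bar\Theta=(\omega,\chi)$, with values in $\mathfrak{gl}\ltimes\mathbb R^{\bar n}$; its curvature is $\bar{\mathcal R}=d\bar\Theta+\frac12[\bar\Theta,\bar\Theta]=(\mathcal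 R,T)$, and for a connection form $\Theta$ with curvature $\mathcal K$ the Yang–Mills operator, projected on the base, is $(\Delta\mathcal K)_W=\hat\delta\mathcal K+*^{-1}[\Theta,*\mathcal K]$. For a tensor field $Q_{\alpha\beta}$ let $$\bar{\mathcal J}_W(Q)=\bigl((\Delta\mathcal R)_W,\ \hat\delta T+*^{-1}[\omega,*T]+\mathrm{Ri}(Q)\bigr),\qquad \mathrm{Ri}(Q)^\alpha=-\chi^\alpha_{\ \varphi}g^{\varphi\lambda}Q_{\lambda\mu}\,\delta u^\mu .$$ **Theorem.** On every such region $W$ with every such section, the Einstein equations on $W$ are equivalent to the Yang–Mills equations $$(\Delta\bar{\mathcal R})_W=\bar{\mathcal J}_W\Bigl(E_{\alpha\beta}-\tfrac1{\bar n-2}\,g_{\alpha\beta}E\Bigr).$$ Consequently the Einstein equations hold on all of $V$ if and only if these Yang–Mills equations hold for all members of any given family of such regions with sections that covers every chart of the atlas. For $\bar n=4$ the source is $\bar{\mathcal J}_W(E_{\alpha\beta}-\frac12g_{\alpha\beta}E)$. -/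

import Mathlib

open scoped ContDiff Manifold

noncomputable section

namespace HaGravity

/-! ### Indices and coordinates -/

/-- Indices of a spacetime of dimension `n + m₁ + ⋯ + m_z`: an index is a shell `p` together with a
number below `m p`.  Shell `0` is the horizontal one (so `m 0 = n`); the shells `1, …, z` are the
vertical ones. -/
abbrev Idx {z : ℕ} (m : Fin (z + 1) → ℕ) : Type := Σ p : Fin (z + 1), Fin (m p)

/-- The total dimension `n + m₁ + ⋯ + m_z`. -/
abbrev dim {z : ℕ} (m : Fin (z + 1) → ℕ) : ℕ := ∑ p, m p

/-- The coordinate space `u = (x, y₁, …, y_z)`. -/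
abbrev Coord {z : ℕ} (m : Fin (z + 1) → ℕ) : Type := Idx m → ℝ

/-! ### Local components of a higher order anisotropic structure -/

/-- Components of the fields in one coordinate system: `N a b` is `N_a^b`, `g α β` is the d-metric
`g_{αβ}` in the adapted frame, and `Γ α β γ` is `Γ^α_{βγ}`, where `D_{δ_γ} δ_β = Γ^α_{βγ} δ_α`. -/
structure HaData {z : ℕ} (m : Fin (z + 1) → ℕ) where
  N : Idx m → Idx m → Coord m → ℝ
  g : Idx m → Idx m → Coord m → ℝ
  Γ : Idx m → Idx m → Idx m → Coord m → ℝ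

namespace HaData

variable {z : ℕ} {m : Fin (z + 1) → ℕ}

/-- The matrix of the adapted frame, `δ_α = ∂_α - N_α^b ∂_b`. -/
def frameMatrix (H : HaData m) (u : Coord m) : Matrix (Idx m) (Idx m) ℝ :=
  Matrix.of fun α b => (if α = b then 1 else 0) - H.N α b u

/-- The adapted frame vector field `δ_α`. -/
def frame (H : HaData m) (α : Idx m) (u : Coord m) : Coord m := fun b => H.frameMatrix u α b

/-- The adapted coframe `δu^β`, dual to the frame `δ_α`. -/
def coframe (H : HaData m) (β : Idx m) (u : Coord m) : Coord m →L[ℝ] ℝ :=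
  ∑ a, (H.frameMatrix u)⁻¹ a β • ContinuousLinearMap.proj (R := ℝ) (φ := fun _ : Idx m => ℝ) a

/-- The derivative `δ_γ f`. -/
def del (H : HaData m) (γ : Idx m) (f : Coord m → ℝ) (u : Coord m) : ℝ :=
  fderiv ℝ f u (H.frame γ u)

/-- The anholonomy coefficients, `δ_α δ_β - δ_β δ_α = w^γ_{αβ} δ_γ`. -/
def anholonomy (H : HaData m) (γ α β : Idx m) (u : Coord m) : ℝ :=
  H.coframe γ u (VectorField.lieBracket ℝ (H.frame α) (H.frame β) u)

/-- The matrix `g_{αβ}`. -/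
def metricMatrix (H : HaData m) (u : Coord m) : Matrix (Idx m) (Idx m) ℝ :=
  Matrix.of fun α β => H.g α β u

/-- The inverse metric `g^{αβ}`. -/
def gInv (H : HaData m) (α β : Idx m) (u : Coord m) : ℝ := (H.metricMatrix u)⁻¹ α β

/-- The components `(D_γ g)_{αβ}`. -/
def covMetric (H : HaData m) (γ α β : Idx m) (u : Coord m) : ℝ :=
  H.del γ (H.g α β) u - ∑ φ, H.Γ φ α γ u * H.g φ β u - ∑ φ, H.Γ φ β γ u * H.g α φ u

/-- On the open set `U`, the components form a higher order N-connection, a (pseudo-Riemannian)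
d-metric and a d-connection compatible with it. -/
structure IsHa (H : HaData m) (U : Set (Coord m)) : Prop where
  N_smooth : ∀ a b, ContDiffOn ℝ ∞ (H.N a b) U
  g_smooth : ∀ α β, ContDiffOn ℝ ∞ (H.g α β) U
  Γ_smooth : ∀ α β γ, ContDiffOn ℝ ∞ (H.Γ α β γ) U
  /-- `N_a^b` is present only if the shell of `b` is above the shell of `a`. -/
  N_shell : ∀ u ∈ U, ∀ a b : Idx m, ¬ a.1 < b.1 → H.N a b u = 0
  g_symm : ∀ u ∈ U, ∀ α β, H.g α β u = H.g β α u
  g_block : ∀ u ∈ U, ∀ α β : Idx m, α.1 ≠ β.1 → H.g α β u = 0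
  g_nondeg : ∀ u ∈ U, (H.metricMatrix u).det ≠ 0
  /-- The connection preserves the splitting into horizontal and vertical vectors. -/
  Γ_hv : ∀ u ∈ U, ∀ α β γ : Idx m, ¬ (α.1 = 0 ↔ β.1 = 0) → H.Γ α β γ u = 0
  metric_compat : ∀ u ∈ U, ∀ γ α β, H.covMetric γ α β u = 0

/-- The curvature `R_β{}^α{}_{γτ}`, where `R(δ_τ, δ_γ) δ_β = R_β{}^α{}_{γτ} δ_α`. -/
def curv (H : HaData m) (β α γ τ : Idx m) (u : Coord m) : ℝ :=
  H.del τ (H.Γ α β γ) u - H.del γ (H.Γ α β τ) u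
    + ∑ φ, H.Γ φ β γ u * H.Γ α φ τ u - ∑ φ, H.Γ φ β τ u * H.Γ α φ γ u
    + ∑ φ, H.Γ α β φ u * H.anholonomy φ γ τ u

/-! ### The Ricci d-tensor and the Einstein equations in h-v form -/

/-- The horizontal part `R_{ij} = R_i{}^k{}_{jk}` (`k` horizontal). -/
def ricH (H : HaData m) (i j : Idx m) (u : Coord m) : ℝ :=
  ∑ k with k.1 = 0, H.curv i k j k u

/-- The vertical part `S_{ab} = S_a{}^c{}_{bc}` (`c` vertical). -/
def ricS (H : HaData m) (a b : Idx m) (u : Coord m) : ℝ :=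
  ∑ c with c.1 ≠ 0, H.curv a c b c u

/-- The mixed part `¹P_{ab} = P_a{}^c{}_{bc}` (`c` vertical), for `a` in a higher shell than `b`. -/
def ricP1 (H : HaData m) (a b : Idx m) (u : Coord m) : ℝ :=
  ∑ c with c.1 ≠ 0, H.curv a c b c u

/-- The mixed part `²P_{ba} = P_b{}^c{}_{ca}`, for `b` in a lower shell than `a`; here `c` is
horizontal if `b` is, and vertical if `b` is. -/
def ricP2 (H : HaData m) (b a : Idx m) (u : Coord m) : ℝ :=
  ∑ c with (c.1 = 0 ↔ b.1 = 0), H.curv b c c a u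

/-- The horizontal scalar `R̂ = g^{ij} R_{ij}`. -/
def scalarH (H : HaData m) (u : Coord m) : ℝ :=
  ∑ i with i.1 = 0, ∑ j with j.1 = 0, H.gInv i j u * H.ricH i j u

/-- The vertical scalar `S̄ = h^{ab} S_{ab}`. -/
def scalarS (H : HaData m) (u : Coord m) : ℝ :=
  ∑ a with a.1 ≠ 0, ∑ b with b.1 ≠ 0, H.gInv a b u * H.ricS a b u

/-- The Einstein equations at the point `u`, in h-v form, with right hand side `Q_{αβ}`. -/
def EinsteinAt (H : HaData m) (Q : Idx m → Idx m → Coord m → ℝ) (u : Coord m) : Prop :=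
  (∀ i j : Idx m, i.1 = 0 → j.1 = 0 →
      H.ricH i j u - 1 / 2 * (H.scalarH u + H.scalarS u) * H.g i j u = Q i j u) ∧
  (∀ a b : Idx m, a.1 ≠ 0 → b.1 ≠ 0 →
      H.ricS a b u - 1 / 2 * (H.scalarH u + H.scalarS u) * H.g a b u = Q a b u) ∧
  (∀ a b : Idx m, b.1 < a.1 → H.ricP1 a b u = Q a b u) ∧
  (∀ a b : Idx m, b.1 < a.1 → H.ricP2 b a u = - Q b a u)

/-- The trace `g^{αβ} Q_{αβ}`. -/
def trace (H : HaData m) (Q : Idx m → Idx m → Coord m → ℝ) (u : Coord m) : ℝ :=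
  ∑ α, ∑ β, H.gInv α β u * Q α β u

/-- `E_{αβ} = k Υ_{αβ} - λ g_{αβ}`. -/
def matterE (H : HaData m) (k lam : ℝ) (Υ : Idx m → Idx m → Coord m → ℝ)
    (α β : Idx m) (u : Coord m) : ℝ :=
  k * Υ α β u - lam * H.g α β u

/-- `Q_{αβ} - c g_{αβ} Q`, where `Q = g^{αβ} Q_{αβ}`. -/
def traceShift (H : HaData m) (c : ℝ) (Q : Idx m → Idx m → Coord m → ℝ)
    (α β : Idx m) (u : Coord m) : ℝ :=
  Q α β u - c * H.g α β u * H.trace Q u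

end HaData

/-! ### Exterior algebra -/

/-- Alternating `r`-forms at a point. -/
abbrev Form {z : ℕ} (m : Fin (z + 1) → ℕ) (r : ℕ) : Type := Coord m [⋀^Fin r]→L[ℝ] ℝ

section Exterior

variable {z : ℕ} {m : Fin (z + 1) → ℕ}

/-- A covector as a form of degree one. -/
def oneForm (α : Coord m →L[ℝ] ℝ) : Form m 1 :=
  ContinuousAlternatingMap.ofSubsingleton ℝ (Coord m) ℝ (0 : Fin 1) α

/-- `α ∧ β` for a covector `α` and an `r`-form `β`:
`(α ∧ β)(v₀, …, v_r) = ∑ i, (-1)^i α(v_i) β(v₀, …, v̂_i, …, v_r)`. -/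
def wedge {r : ℕ} (α : Coord m →L[ℝ] ℝ) (β : Form m r) : Form m (r + 1) :=
  ContinuousAlternatingMap.alternatizeUncurryFin (α.smulRight β)

/-- `e¹ ∧ ⋯ ∧ e^s` for covectors `e`: its value on `w₁, …, w_s` is `det (e^i(w_j))`. -/
def wedgeCovectors {s : ℕ} (e : Fin s → Coord m →L[ℝ] ℝ) : Form m s :=
  { (Matrix.detRowAlternating (n := Fin s) (R := ℝ)).compLinearMap
      (LinearMap.pi fun i => (e i : Coord m →ₗ[ℝ] ℝ)) with
    cont := by
      change Continuous fun w : Fin s → Coord m => Matrix.det fun j i => e i (w j)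
      refine Continuous.matrix_det ?_
      fun_prop }

/-- The sign of `f : Fin k → Idx m` as a permutation of all the indices (which are ordered shell
by shell), and `0` if an index is repeated; used for `k = dim m` only. -/
def permSign {k : ℕ} (f : Fin k → Idx m) : ℝ :=
  Matrix.det (Matrix.of fun i j : Fin k =>
    if (finSigmaFinEquiv (f i) : ℕ) = (j : ℕ) then (1 : ℝ) else 0)

/-- The Hodge operator from `r`-forms to `s`-forms, `r + s = dim m`, of a metric with orthonormal
coframe `e`, dual frame `X` and signs `η`:
`*(e^{μ₁} ∧ ⋯ ∧ e^{μ_r}) = η(ν₁) ⋯ η(ν_s) sign(μ₁ … μ_r ν₁ … ν_s) e^{ν₁} ∧ ⋯ ∧ e^{ν_s}`. -/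
def hodge (e : Idx m → Coord m →L[ℝ] ℝ) (X : Idx m → Coord m) (η : Idx m → ℝ) (r s : ℕ)
    (β : Form m r) : Form m s :=
  ((r.factorial : ℝ) * (s.factorial : ℝ))⁻¹ • ∑ μ : Fin r → Idx m, ∑ ν : Fin s → Idx m,
    ((∏ j, η (ν j)) * permSign (Fin.append μ ν) * β (fun i => X (μ i))) •
      wedgeCovectors (fun j => e (ν j))

/-- `*⁻¹ = η(1) ⋯ η(dim) (-1)^{rs} *` on `r`-forms, `r + s = dim m`. -/
def hodgeInv (e : Idx m → Coord m →L[ℝ] ℝ) (X : Idx m → Coord m) (η : Idx m → ℝ) (r s : ℕ)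
    (β : Form m r) : Form m s :=
  ((∏ μ, η μ) * (-1) ^ (r * s)) • hodge e X η r s β

/-- The bracket `[θ, Φ]` of a matrix-valued 1-form and a matrix-valued `r`-form,
`[Δ_a ⊗ θ^a, Δ_b ⊗ Φ^b] = [Δ_a, Δ_b] ⊗ θ^a ∧ Φ^b`. -/
def bracket {κ : Type} [Fintype κ] {r : ℕ} (θ : Matrix κ κ (Coord m →L[ℝ] ℝ))
    (Φ : Matrix κ κ (Form m r)) : Matrix κ κ (Form m (r + 1)) :=
  Matrix.of fun A B => ∑ C, (wedge (θ A C) (Φ C B) - wedge (θ C B) (Φ A C))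

/-- The curvature `dθ + ½ [θ, θ]` of a matrix-valued connection form. -/
def curvatureForm {κ : Type} [Fintype κ] (θ : Coord m → Matrix κ κ (Coord m →L[ℝ] ℝ))
    (u : Coord m) : Matrix κ κ (Form m 2) :=
  Matrix.of fun A B => extDeriv (fun v => oneForm (θ v A B)) u
    + (1 / 2 : ℝ) • bracket (θ u) ((θ u).map oneForm) A B

end Exterior

/-! ### Spacetimes -/

section Spacetime

variable {z : ℕ} {m : Fin (z + 1) → ℕ}

/-- The coefficients `A_α^β` in `dτ(δ_α) = A_α^β δ'_β ∘ τ`, for a change of coordinates `τ`. -/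
def frameChange (H H' : HaData m) (τ : Coord m → Coord m) (α β : Idx m) (u : Coord m) : ℝ :=
  H'.coframe β (τ u) (fderiv ℝ τ u (H.frame α u))

/-- A higher order anisotropic spacetime: in every coordinate system of the atlas of `V`, an
N-connection, a d-metric and a compatible d-connection, with the transformation laws of a splitting
of the tangent bundle, of a tensor and of a linear connection. -/
structure HaSpacetime (m : Fin (z + 1) → ℕ) (V : Type*) [TopologicalSpace V]
    [ChartedSpace (Coord m) V] where
  data : atlas (Coord m) V → HaData m
  isHa : ∀ c, (data c).IsHa c.1.target
  frame_law : ∀ c c' : atlas (Coord m) V, ∀ u ∈ (c.1.symm.trans c'.1).source,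
    ∀ α β : Idx m, α.1 ≠ β.1 → frameChange (data c) (data c') (c.1.symm.trans c'.1) α β u = 0
  metric_law : ∀ c c' : atlas (Coord m) V, ∀ u ∈ (c.1.symm.trans c'.1).source, ∀ α β : Idx m,
    (data c).g α β u = ∑ γ, ∑ ε,
      frameChange (data c) (data c') (c.1.symm.trans c'.1) α γ u *
      frameChange (data c) (data c') (c.1.symm.trans c'.1) β ε u *
      (data c').g γ ε (c.1.symm.trans c'.1 u)
  connection_law : ∀ c c' : atlas (Coord m) V, ∀ u ∈ (c.1.symm.trans c'.1).source,
    ∀ β γ ε : Idx m,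
    ∑ α, (data c).Γ α β γ u * frameChange (data c) (data c') (c.1.symm.trans c'.1) α ε u =
      (data c).del γ (frameChange (data c) (data c') (c.1.symm.trans c'.1) β ε) u +
      ∑ φ, ∑ ψ, frameChange (data c) (data c') (c.1.symm.trans c'.1) β φ u *
        frameChange (data c) (data c') (c.1.symm.trans c'.1) γ ψ u *
        (data c').Γ ε φ ψ (c.1.symm.trans c'.1 u)

/-- A covariant d-tensor field `Υ_{αβ}` of rank two, by its components in the adapted frames. -/
structure DTensor {V : Type*} [TopologicalSpace V] [ChartedSpace (Coord m) V]
    (S : HaSpacetime m V) where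
  comp : atlas (Coord m) V → Idx m → Idx m → Coord m → ℝ
  law : ∀ c c' : atlas (Coord m) V, ∀ u ∈ (c.1.symm.trans c'.1).source, ∀ α β : Idx m,
    comp c α β u = ∑ γ, ∑ ε,
      frameChange (S.data c) (S.data c') (c.1.symm.trans c'.1) α γ u *
      frameChange (S.data c) (S.data c') (c.1.symm.trans c'.1) β ε u *
      comp c' γ ε (c.1.symm.trans c'.1 u)

/-- A smooth matrix function on `W` describing an adapted coframe `E^α̂ = E^α̂_μ δu^μ`. -/
structure IsAdapted (W : Set (Coord m)) (E : Coord m → Matrix (Idx m) (Idx m) ℝ) : Prop where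
  smooth : ∀ α μ, ContDiffOn ℝ ∞ (fun u => E u α μ) W
  block : ∀ u ∈ W, ∀ α μ : Idx m, α.1 ≠ μ.1 → E u α μ = 0
  nondeg : ∀ u ∈ W, (E u).det ≠ 0

/-- A region `W` in a chart, with an orthonormal adapted coframe `e` (used for the Hodge operator)
and a local section of the bundle of adapted frames, given by its dual coframe `χ`.  The choices
`χ = e` (an orthonormal frame) and `χ = 1` (the frame `δ_α`) are included. -/
structure Gauge {V : Type*} [TopologicalSpace V] [ChartedSpace (Coord m) V]
    (S : HaSpacetime m V) where
  chart : atlas (Coord m) V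
  W : Set (Coord m)
  isOpen : IsOpen W
  subset : W ⊆ chart.1.target
  e : Coord m → Matrix (Idx m) (Idx m) ℝ
  e_adapted : IsAdapted W e
  η : Idx m → ℝ
  η_sign : ∀ α, η α = 1 ∨ η α = -1
  orthonormal : ∀ u ∈ W, ∀ μ ν,
    (S.data chart).g μ ν u = ∑ α, η α * e u α μ * e u α ν
  χ : Coord m → Matrix (Idx m) (Idx m) ℝ
  χ_adapted : IsAdapted W χ

namespace Gauge

variable {V : Type*} [TopologicalSpace V] [ChartedSpace (Coord m) V] {S : HaSpacetime m V}

/-- The components of the fields in the chart of the region. -/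
abbrev H (G : Gauge S) : HaData m := S.data G.chart

/-- The orthonormal coframe `e^α = e^α_μ δu^μ`. -/
def onCoframe (G : Gauge S) (u : Coord m) (α : Idx m) : Coord m →L[ℝ] ℝ :=
  ∑ μ, G.e u α μ • G.H.coframe μ u

/-- The orthonormal frame, dual to `e`. -/
def onFrame (G : Gauge S) (u : Coord m) (α : Idx m) : Coord m :=
  ∑ μ, (G.e u)⁻¹ μ α • G.H.frame μ u

/-- The Hodge operator of the metric. -/
def star (G : Gauge S) (r s : ℕ) (u : Coord m) (β : Form m r) : Form m s :=
  hodge (G.onCoframe u) (G.onFrame u) G.η r s β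

/-- The inverse Hodge operator. -/
def starInv (G : Gauge S) (r s : ℕ) (u : Coord m) (β : Form m r) : Form m s :=
  hodgeInv (G.onCoframe u) (G.onFrame u) G.η r s β

/-- The codifferential `δ̂ = (-1)^r *⁻¹ ∘ d ∘ *` on 2-forms. -/
def codiff (G : Gauge S) (β : Coord m → Form m 2) (u : Coord m) : Form m 1 :=
  (-1 : ℝ) ^ 2 • G.starInv (dim m - 2 + 1) 1 u
    (extDeriv (fun v => G.star 2 (dim m - 2) v (β v)) u)

/-- The projection on the base of `Δ K`, for a connection form `θ` and a 2-form `K`, both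
matrix-valued: `(Δ K)_W = δ̂ K + *⁻¹ [θ, * K]`. -/
def yangMillsOp (G : Gauge S) {κ : Type} [Fintype κ]
    (θ : Coord m → Matrix κ κ (Coord m →L[ℝ] ℝ)) (K : Coord m → Matrix κ κ (Form m 2))
    (u : Coord m) : Matrix κ κ (Form m 1) :=
  Matrix.of fun A B => G.codiff (fun v => K v A B) u
    + G.starInv (dim m - 2 + 1) 1 u
        (bracket (θ u) ((K u).map (G.star 2 (dim m - 2) u)) A B)

/-- The shifting form `χ^α = χ^α_μ δu^μ`. -/
def shift (G : Gauge S) (u : Coord m) (α : Idx m) : Coord m →L[ℝ] ℝ :=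
  ∑ μ, G.χ u α μ • G.H.coframe μ u

/-- The connection form of the d-connection in the bundle of adapted linear frames:
`θ^α_β = (χ^α_φ Γ^φ_{ψγ} (χ⁻¹)^ψ_β + χ^α_φ δ_γ (χ⁻¹)^φ_β) δu^γ`. -/
def linConn (G : Gauge S) (u : Coord m) : Matrix (Idx m) (Idx m) (Coord m →L[ℝ] ℝ) :=
  Matrix.of fun α β => ∑ γ,
    ((∑ φ, ∑ ψ, G.χ u α φ * G.H.Γ φ ψ γ u * (G.χ u)⁻¹ ψ β)
      + ∑ φ, G.χ u α φ * G.H.del γ (fun v => (G.χ v)⁻¹ φ β) u) • G.H.coframe γ u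

/-- The curvature of the linear connection. -/
def linCurv (G : Gauge S) (u : Coord m) : Matrix (Idx m) (Idx m) (Form m 2) :=
  curvatureForm G.linConn u

/-- The Cartan connection `(θ, χ)` in the bundle of adapted affine frames.  The affine Lie algebra
is realized by the matrices with blocks `A, v, 0, 0`, where `A` is the linear part and `v` the
translation part. -/
def cartanConn (G : Gauge S) (u : Coord m) :
    Matrix (Idx m ⊕ Unit) (Idx m ⊕ Unit) (Coord m →L[ℝ] ℝ) :=
  Matrix.fromBlocks (G.linConn u) (Matrix.of fun α _ => G.shift u α) 0 0

/-- The curvature of the Cartan connection. -/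
def cartanCurv (G : Gauge S) (u : Coord m) :
    Matrix (Idx m ⊕ Unit) (Idx m ⊕ Unit) (Form m 2) :=
  curvatureForm G.cartanConn u

/-- The torsion `T^α = dχ^α + θ^α_β ∧ χ^β`. -/
def torsion (G : Gauge S) (u : Coord m) (α : Idx m) : Form m 2 :=
  extDeriv (fun v => oneForm (G.shift v α)) u
    + ∑ β, wedge (G.linConn u α β) (oneForm (G.shift u β))

/-- The torsion term `(Rτ)^α = δ̂ T^α + *⁻¹ (θ^α_β ∧ * T^β)`. -/
def torsionTerm (G : Gauge S) (u : Coord m) (α : Idx m) : Form m 1 :=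
  G.codiff (fun v => G.torsion v α) u
    + G.starInv (dim m - 2 + 1) 1 u
        (∑ β, wedge (G.linConn u α β) (G.star 2 (dim m - 2) u (G.torsion u β)))

/-- The form `(Ri)^α = - χ^α_φ g^{φλ} Q_{λμ} δu^μ` built from a tensor `Q`. -/
def ricciTerm (G : Gauge S) (Q : Idx m → Idx m → Coord m → ℝ) (u : Coord m) (α : Idx m) :
    Form m 1 :=
  -∑ μ, (∑ φ, ∑ l, G.χ u α φ * G.H.gInv φ l u * Q l μ u) • oneForm (G.H.coframe μ u)

/-- The source `((Δ R)_W, (Rτ)_W + (Ri)_W)`, with the form `(Ri)_W` built from `Q`. -/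
def source (G : Gauge S) (Q : Idx m → Idx m → Coord m → ℝ) (u : Coord m) :
    Matrix (Idx m ⊕ Unit) (Idx m ⊕ Unit) (Form m 1) :=
  Matrix.fromBlocks (G.yangMillsOp G.linConn G.linCurv u)
    (Matrix.of fun α _ => G.torsionTerm u α + G.ricciTerm Q u α) 0 0

/-- The Yang-Mills equations `(Δ R̄)_W = J̄_W` of the Cartan connection on the region `W`. -/
def YangMills (G : Gauge S) (Q : Idx m → Idx m → Coord m → ℝ) : Prop :=
  ∀ u ∈ G.W, G.yangMillsOp G.cartanConn G.cartanCurv u = G.source Q u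

/-- `E_{αβ} = k Υ_{αβ} - λ g_{αβ}` in the chart of the region. -/
abbrev E (G : Gauge S) (Υ : DTensor S) (k lam : ℝ) : Idx m → Idx m → Coord m → ℝ :=
  G.H.matterE k lam (Υ.comp G.chart)

end Gauge

/-- The Einstein equations on the whole spacetime, with right hand side `k Υ_{αβ} - λ g_{αβ}`. -/
def HaSpacetime.Einstein {V : Type*} [TopologicalSpace V] [ChartedSpace (Coord m) V]
    (S : HaSpacetime m V) (Υ : DTensor S) (k lam : ℝ) : Prop :=
  ∀ c : atlas (Coord m) V, ∀ u ∈ c.1.target,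
    (S.data c).EinsteinAt ((S.data c).matterE k lam (Υ.comp c)) u

end Spacetime

end HaGravity

end

/-! In the affine Lie algebra the linear block of the connection never meets the translation block,
so the Yang–Mills operator of the Cartan connection has the linear block `ΔR`, while its translation
column is the torsion term minus `Σ_β *⁻¹(χ^β ∧ *R^α_β)` (`Gauge.yangMillsOp_cartan`). The source
contains the same `ΔR` and the same torsion term. Everything involving derivatives of the curvature
or torsion therefore cancels, and the Yang–Mills equations become the algebraic condition `-Σ_β
*⁻¹(χ^β ∧ *R^α_β) = Ri(Q)^α`.

The left side is a contraction: for a 2-form `K` and an orthonormal coframe, `*⁻¹(e^l ∧ *K) = -η_l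
K(X_l, ·)` (`hodgeInv_wedge_hodge`, which rests on summing products of sign symbols). Hence one
frame index of the curvature is contracted with one form index. Since `Dg = 0`, the curvature with
an index raised is skew (`HaData.IsHa.curv_skew`), and the contraction becomes `χ g⁻¹ Ric`
(`Gauge.sum_starInv_wedge_shift_apply`). The invertible factor `χ g⁻¹` also stands in front of `Q`,
so the equations say exactly `Ric = Q` (`Gauge.yangMills_iff`).

On the other side, the curvature preserves the horizontal-vertical splitting and `g` is block
diagonal, so the four families of Einstein equations together are `Ric - ½ (tr Ric) g = E`
(`HaData.IsHa.einsteinAt_iff`). Trace reversal, possible for dimension at least 3, turns this into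
`Ric = E - g tr E / (n - 2)`. All of this is pointwise, so a covering family of regions gives the
global statement. -/

namespace HaGravity

/-! ### Calculus of matrix-valued functions -/

section MatrixCalculus

variable {E ι : Type*} [NormedAddCommGroup E] [NormedSpace ℝ E]

/-- All entries of the matrix function are smooth on `W`. -/
def MatSmoothOn (W : Set E) (F : E → Matrix ι ι ℝ) : Prop :=
  ∀ a b, ContDiffOn ℝ ∞ (fun v => F v a b) W

/-- The entrywise derivative of a matrix function in the direction `X`. -/
noncomputable def dMat (F : E → Matrix ι ι ℝ) (X u : E) : Matrix ι ι ℝ :=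
  Matrix.of fun a b => fderiv ℝ (fun v => F v a b) u X

variable {W : Set E} {F G : E → Matrix ι ι ℝ} {u : E}

theorem MatSmoothOn.differentiableAt (hF : MatSmoothOn W F) (hW : IsOpen W) (hu : u ∈ W)
    (a b : ι) : DifferentiableAt ℝ (fun v => F v a b) u :=
  ((hF a b).contDiffAt (hW.mem_nhds hu)).differentiableAt (by simp)

theorem MatSmoothOn.add (hF : MatSmoothOn W F) (hG : MatSmoothOn W G) :
    MatSmoothOn W (fun v => F v + G v) := fun a b => (hF a b).add (hG a b)

theorem MatSmoothOn.transpose (hF : MatSmoothOn W F) :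
    MatSmoothOn W (fun v => (F v).transpose) := fun a b => hF b a

theorem MatSmoothOn.mul [Fintype ι] (hF : MatSmoothOn W F) (hG : MatSmoothOn W G) :
    MatSmoothOn W (fun v => F v * G v) := fun a b => by
  simp only [Matrix.mul_apply]
  exact ContDiffOn.sum fun c _ => (hF a c).mul (hG c b)

theorem MatSmoothOn.dMat (hF : MatSmoothOn W F) (hW : IsOpen W) (X : E) :
    MatSmoothOn W (HaGravity.dMat F X) := fun a b =>
  ((hF a b).fderiv_of_isOpen (m := ∞) hW (by simp)).clm_apply contDiffOn_const

theorem contDiffOn_det [Fintype ι] [DecidableEq ι] (hF : MatSmoothOn W F) :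
    ContDiffOn ℝ ∞ (fun v => (F v).det) W := by
  simp only [Matrix.det_apply]
  exact ContDiffOn.sum fun σ _ => (contDiffOn_prod fun i _ => hF _ _).const_smul _

theorem MatSmoothOn.inv [Fintype ι] [DecidableEq ι] (hF : MatSmoothOn W F)
    (h : ∀ v ∈ W, (F v).det ≠ 0) : MatSmoothOn W (fun v => (F v)⁻¹) := fun a b => by
  -- Cramer's rule: each adjugate entry is the determinant of the matrix with one row replaced by a
  -- constant row.
  simp only [Matrix.inv_def, Matrix.smul_apply, Ring.inverse_eq_inv', smul_eq_mul,
    Matrix.adjugate_apply]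
  refine ((contDiffOn_det hF).inv h).mul (contDiffOn_det fun i j => ?_)
  simp only [Matrix.updateRow_apply]
  split_ifs
  · exact contDiffOn_const
  · exact hF i j

theorem dMat_add (hF : MatSmoothOn W F) (hG : MatSmoothOn W G) (hW : IsOpen W) (hu : u ∈ W)
    (X : E) : dMat (fun v => F v + G v) X u = dMat F X u + dMat G X u := by
  ext a b
  simp only [dMat, Matrix.of_apply, Matrix.add_apply]
  rw [fderiv_fun_add (hF.differentiableAt hW hu a b) (hG.differentiableAt hW hu a b)]
  rfl

theorem dMat_mul [Fintype ι] (hF : MatSmoothOn W F) (hG : MatSmoothOn W G) (hW : IsOpen W)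
    (hu : u ∈ W) (X : E) :
    dMat (fun v => F v * G v) X u = dMat F X u * G u + F u * dMat G X u := by
  ext a b
  simp only [dMat, Matrix.of_apply, Matrix.add_apply, Matrix.mul_apply]
  rw [fderiv_fun_sum fun c _ =>
    (hF.differentiableAt hW hu a c).fun_mul (hG.differentiableAt hW hu c b)]
  rw [sum_apply, ← Finset.sum_add_distrib]
  refine Finset.sum_congr rfl fun c _ => ?_
  rw [fderiv_fun_mul (hF.differentiableAt hW hu a c) (hG.differentiableAt hW hu c b)]
  simp only [add_apply, smul_apply, smul_eq_mul]
  ring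

theorem dMat_congr (h : Set.EqOn F G W) (hW : IsOpen W) (hu : u ∈ W) (X : E) :
    dMat F X u = dMat G X u := by
  ext a b
  simp only [dMat, Matrix.of_apply]
  rw [Filter.EventuallyEq.fderiv_eq]
  filter_upwards [hW.mem_nhds hu] with v hv
  rw [h hv]

theorem dMat_comm (hF : MatSmoothOn W F) (hW : IsOpen W) (hu : u ∈ W) (X Y : E) :
    dMat (dMat F Y) X u = dMat (dMat F X) Y u := by
  ext a b
  have h := (hF a b).contDiffAt (hW.mem_nhds hu)
  have hd : DifferentiableAt ℝ (fderiv ℝ fun v => F v a b) u :=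
    (h.fderiv_right (m := 1) (by norm_cast)).differentiableAt (by simp)
  have hs := (h.isSymmSndFDerivAt (by
    rw [minSmoothness_of_isRCLikeNormedField, ← one_add_one_eq_two]
    norm_cast)).eq X Y
  simp only [dMat, Matrix.of_apply]
  rw [fderiv_clm_apply hd (differentiableAt_const _), fderiv_clm_apply hd (differentiableAt_const _)]
  simpa using hs

/-- The curvature `X B(Y) - Y B(X) + [B(X), B(Y)]` of a matrix-valued one-form on constant
vector fields. -/
noncomputable def curvMat [Fintype ι] (B : E → E → Matrix ι ι ℝ) (X Y u : E) : Matrix ι ι ℝ :=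
  dMat (B Y) X u - dMat (B X) Y u + B X u * B Y u - B Y u * B X u

/-- A change of frame conjugates the curvature. -/
theorem curvMat_gauge [Fintype ι] [DecidableEq ι] {B : E → E → Matrix ι ι ℝ}
    {P Q : E → Matrix ι ι ℝ} (hB : ∀ X, MatSmoothOn W (B X)) (hP : MatSmoothOn W P)
    (hQ : MatSmoothOn W Q) (hW : IsOpen W) (hu : u ∈ W) (hPQ : ∀ v ∈ W, P v * Q v = 1) (X Y : E) :
    curvMat (fun Z v => P v * B Z v * Q v + P v * dMat Q Z v) X Y u
      = P u * curvMat B X Y u * Q u := by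
  have hQP : Q u * P u = 1 := mul_eq_one_comm.1 (hPQ u hu)
  -- Differentiating `P Q = 1` expresses `dP` through `dQ`, so that only derivatives of `Q` remain.
  have hd (Z : E) : dMat P Z u = -(P u * dMat Q Z u * P u) := by
    have h : dMat (fun v => P v * Q v) Z u = 0 := by
      rw [dMat_congr (G := fun _ => 1) hPQ hW hu]
      ext a b
      simp [dMat]
    rw [dMat_mul hP hQ hW hu] at h
    have h2 := congrArg (· * P u) (eq_neg_of_add_eq_zero_left h)
    simpa [mul_assoc, hQP] using h2
  have hA (Z T : E) : dMat (fun v => P v * B Z v * Q v + P v * dMat Q Z v) T u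
      = -(P u * dMat Q T u * P u) * B Z u * Q u + P u * dMat (B Z) T u * Q u
        + P u * B Z u * dMat Q T u - (P u * dMat Q T u * P u) * dMat Q Z u
        + P u * dMat (dMat Q Z) T u := by
    rw [dMat_add ((hP.mul (hB Z)).mul hQ) (hP.mul (hQ.dMat hW Z)) hW hu,
      dMat_mul (hP.mul (hB Z)) hQ hW hu, dMat_mul hP (hB Z) hW hu,
      dMat_mul hP (hQ.dMat hW Z) hW hu, hd]
    noncomm_ring
  have hM (Z T : E) : (P u * B Z u * Q u + P u * dMat Q Z u) * (P u * B T u * Q u + P u * dMat Q T u)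
      = P u * B Z u * B T u * Q u + P u * B Z u * dMat Q T u
        + P u * dMat Q Z u * P u * B T u * Q u + P u * dMat Q Z u * P u * dMat Q T u := by
    have h1 (M : Matrix ι ι ℝ) : Q u * (P u * M) = M := by rw [← mul_assoc, hQP, one_mul]
    simp only [add_mul, mul_add, mul_assoc, h1]
    abel
  -- The second derivatives of `Q` cancel by symmetry; the remaining inhomogeneous terms cancel
  -- algebraically.
  simp only [curvMat, hA, hM, dMat_comm hQ hW hu X Y]
  noncomm_ring

/-- The curvature of a metric connection is skew. -/
theorem curvMat_skew [Fintype ι] {B : E → E → Matrix ι ι ℝ} {g : E → Matrix ι ι ℝ}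
    (hB : ∀ X, MatSmoothOn W (B X)) (hg : MatSmoothOn W g) (hW : IsOpen W) (hu : u ∈ W)
    (h : ∀ v ∈ W, ∀ X, dMat g X v = (B X v).transpose * g v + g v * B X v) (X Y : E) :
    (curvMat B X Y u).transpose * g u + g u * curvMat B X Y u = 0 := by
  -- The compatibility equation is differentiated once more and used again to eliminate `dg`.
  -- Antisymmetrizing in the two directions kills the second derivatives of `g` and leaves exactly
  -- the skewness identity.
  have hA (Z T : E) : dMat (dMat g Z) T u = (dMat (B Z) T u).transpose * g u
      + (B Z u).transpose * ((B T u).transpose * g u + g u * B T u)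
      + ((B T u).transpose * g u + g u * B T u) * B Z u + g u * dMat (B Z) T u := by
    rw [dMat_congr (fun v hv => h v hv Z) hW hu,
      dMat_add ((hB Z).transpose.mul hg) (hg.mul (hB Z)) hW hu,
      dMat_mul (hB Z).transpose hg hW hu, dMat_mul hg (hB Z) hW hu, h u hu,
      show dMat (fun v => (B Z v).transpose) T u = (dMat (B Z) T u).transpose from rfl]
    abel
  have hc := dMat_comm hg hW hu X Y
  rw [hA, hA] at hc
  have hc' := sub_eq_zero.2 hc
  rw [← hc']
  simp only [curvMat, Matrix.transpose_sub, Matrix.transpose_add, Matrix.transpose_mul]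
  noncomm_ring

end MatrixCalculus

end HaGravity

namespace HaGravity

/-! ### The sign of a list of indices -/

section PermSign

variable {z : ℕ} {m : Fin (z + 1) → ℕ}

theorem card_idx : Fintype.card (Idx m) = dim m := by simp

theorem permSign_cast {k l : ℕ} (h : k = l) (f : Fin l → Idx m) :
    permSign (f ∘ Fin.cast h) = permSign f := by subst h; rfl

theorem permSign_comp_perm {k : ℕ} (f : Fin k → Idx m) (σ : Equiv.Perm (Fin k)) :
    permSign (f ∘ σ) = (Equiv.Perm.sign σ : ℝ) * permSign f :=
  Matrix.det_permute σ (Matrix.of fun i j : Fin k =>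
    if (finSigmaFinEquiv (f i) : ℕ) = (j : ℕ) then (1 : ℝ) else 0)

theorem permSign_eq_zero {k : ℕ} {f : Fin k → Idx m} (hf : ¬ Function.Injective f) :
    permSign f = 0 := by
  simp only [Function.Injective, not_forall] at hf
  obtain ⟨i, j, hij, hne⟩ := hf
  refine Matrix.det_zero_of_row_eq hne ?_
  ext l
  simp only [Matrix.of_apply, hij]

/-- The 0/1 matrix `A` of an injective full list satisfies `A Aᵀ = 1`. -/
theorem permSign_mul_self {k : ℕ} (hk : k = dim m) {f : Fin k → Idx m}
    (hf : Function.Injective f) : permSign f * permSign f = 1 := by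
  unfold permSign
  nth_rw 2 [← Matrix.det_transpose]
  rw [← Matrix.det_mul]
  refine Eq.trans (congrArg Matrix.det ?_) (Matrix.det_one (n := Fin k))
  ext i j
  -- A list of full length is needed here: otherwise the 1 in a row could lie outside the matrix.
  have hlt : (finSigmaFinEquiv (f i) : ℕ) < k := hk ▸ (finSigmaFinEquiv (f i)).2
  rw [Matrix.mul_apply, Finset.sum_eq_single ⟨_, hlt⟩]
  · simp only [Matrix.of_apply, Matrix.transpose_apply, if_true, one_mul, Matrix.one_apply]
    refine if_congr ?_ rfl rfl
    rw [← Fin.ext_iff, finSigmaFinEquiv.injective.eq_iff, hf.eq_iff, eq_comm]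
  · intro l _ hl
    have : (finSigmaFinEquiv (f i) : ℕ) ≠ l := fun h => hl (Fin.ext h.symm)
    rw [Matrix.of_apply, if_neg this, zero_mul]
  · simp

theorem bijective_of_injective_idx {k : ℕ} (hk : k = dim m) {f : Fin k → Idx m}
    (hf : Function.Injective f) : Function.Bijective f :=
  (Fintype.bijective_iff_injective_and_card f).2 ⟨hf, by rw [card_idx, Fintype.card_fin, hk]⟩

theorem permSign_cons_comp_perm {k : ℕ} (a : Idx m) (f : Fin k → Idx m)
    (σ : Equiv.Perm (Fin k)) :
    permSign (Fin.cons (α := fun _ => Idx m) a (f ∘ σ))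
      = (Equiv.Perm.sign σ : ℝ) * permSign (Fin.cons (α := fun _ => Idx m) a f) := by
  -- `decomposeFin.symm (0, σ)` is `σ` acting on the tail with the head fixed; it has the sign of
  -- `σ`.
  have h : (Fin.cons (α := fun _ => Idx m) a (f ∘ σ))
      = (Fin.cons (α := fun _ => Idx m) a f) ∘ (Equiv.Perm.decomposeFin.symm (0, σ)) := by
    ext1 i
    refine Fin.cases ?_ (fun i => ?_) i <;> simp
  rw [h, permSign_comp_perm, Equiv.Perm.decomposeFin.symm_sign]
  simp

theorem permSign_swap {k : ℕ} (a b : Idx m) (f : Fin k → Idx m) :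
    permSign (Fin.cons (α := fun _ => Idx m) a (Fin.cons (α := fun _ => Idx m) b f))
      = -permSign (Fin.cons (α := fun _ => Idx m) b (Fin.cons (α := fun _ => Idx m) a f)) := by
  have h : (Fin.cons (α := fun _ => Idx m) a (Fin.cons (α := fun _ => Idx m) b f))
      = (Fin.cons (α := fun _ => Idx m) b (Fin.cons (α := fun _ => Idx m) a f))
        ∘ (Equiv.swap (0 : Fin (k + 2)) 1) := by
    ext1 i
    refine Fin.cases ?_ (fun i => Fin.cases ?_ (fun i => ?_) i) i
    · simp only [Function.comp_apply, Equiv.swap_apply_left]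
      rw [show (1 : Fin (k + 2)) = Fin.succ 0 from rfl]
      simp
    · rw [show (Fin.succ 0 : Fin (k + 2)) = 1 from rfl]
      simp only [Function.comp_apply, Equiv.swap_apply_right]
      rw [show (1 : Fin (k + 2)) = Fin.succ 0 from rfl]
      simp
    · rw [Function.comp_apply, Equiv.swap_apply_of_ne_of_ne]
      · simp
      · exact Fin.succ_ne_zero _
      · rw [show (1 : Fin (k + 2)) = Fin.succ 0 from rfl]
        exact fun h' => Fin.succ_ne_zero _ (Fin.succ_injective _ h')
  rw [h, permSign_comp_perm, Equiv.Perm.sign_swap (by simp)]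
  simp

theorem permSign_append_one {k : ℕ} (f : Fin k → Idx m) (σ : Fin 1 → Idx m) :
    permSign (Fin.append f σ)
      = (-1) ^ k * permSign (Fin.cons (α := fun _ => Idx m) (σ 0) f) := by
  rw [Fin.append_right_eq_snoc, Fin.snoc_eq_cons_rotate, ← Function.comp_def,
    permSign_comp_perm, sign_finRotate]
  simp

theorem permSign_append_two {k : ℕ} (μ : Fin 2 → Idx m) (f : Fin k → Idx m) :
    permSign (Fin.append μ f)
      = permSign (Fin.cons (α := fun _ => Idx m) (μ 0)
          (Fin.cons (α := fun _ => Idx m) (μ 1) f)) := by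
  rw [← permSign_cast (show 2 + k = k + 2 by omega)]
  congr 1
  ext1 i
  refine Fin.addCases (fun i => ?_) (fun i => ?_) i
  · rw [Fin.append_left]
    fin_cases i <;> rfl
  · rw [Fin.append_right, Function.comp_apply,
      show Fin.cast (by omega) (Fin.natAdd 2 i) = i.succ.succ from Fin.ext (by simp)]
    simp

/-- The number of ways to complete two distinct indices to a list of all indices. -/
theorem card_injective_cons_cons {s : ℕ} (hs : s + 2 = dim m) {a b : Idx m} (hab : a ≠ b) :
    Fintype.card {ν : Fin s → Idx m // Function.Injective
      (Fin.cons (α := fun _ => Idx m) a (Fin.cons (α := fun _ => Idx m) b ν))} = s.factorial := by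
  have hcard : Fintype.card {x : Idx m // x ∉ ({a, b} : Finset (Idx m))} = s := by
    rw [Fintype.card_subtype_compl, card_idx, Fintype.card_coe, Finset.card_pair hab, ← hs]
    rfl
  -- The admissible completions are the embeddings of `Fin s` into the complement of `{a, b}`, which
  -- has `s` elements.
  have e : {ν : Fin s → Idx m // Function.Injective
      (Fin.cons (α := fun _ => Idx m) a (Fin.cons (α := fun _ => Idx m) b ν))}
      ≃ (Fin s ↪ {x : Idx m // x ∉ ({a, b} : Finset (Idx m))}) :=
    { toFun := fun ν => ⟨fun i => ⟨ν.1 i, by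
          have h := ν.2
          rw [Fin.cons_injective_iff, Fin.cons_injective_iff] at h
          simp only [Finset.mem_insert, Finset.mem_singleton, not_or]
          refine ⟨fun h' => h.1 ⟨i.succ, by simpa using h'⟩, fun h' => h.2.1 ⟨i, h'⟩⟩⟩, by
        have h := ν.2
        rw [Fin.cons_injective_iff, Fin.cons_injective_iff] at h
        exact fun i j hij => h.2.2 (congrArg Subtype.val hij)⟩
      invFun := fun f => ⟨fun i => (f i).1, by
        rw [Fin.cons_injective_iff, Fin.cons_injective_iff]
        have h (i : Fin s) := (f i).2
        simp only [Finset.mem_insert, Finset.mem_singleton, not_or] at h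
        refine ⟨?_, ?_, fun i j hij => f.injective (Subtype.ext hij)⟩
        · rintro ⟨i, hi⟩
          revert hi
          refine Fin.cases ?_ (fun i => ?_) i
          · exact fun h' => hab h'.symm
          · exact fun h' => (h i).1 h'
        · rintro ⟨i, hi⟩
          exact (h i).2 hi⟩
      left_inv := fun _ => rfl
      right_inv := fun _ => rfl }
  rw [Fintype.card_congr e, Fintype.card_embedding_eq, hcard, Fintype.card_fin,
    Nat.descFactorial_self]

/-- With a common tail `ν`, the pair `c, d` can complete the list only if it is `a, b` in one of the
two orders, and exchanging the order flips the sign. -/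
theorem permSign_mul_permSign {s : ℕ} (hs : s + 2 = dim m) {a b : Idx m} (c d : Idx m)
    {ν : Fin s → Idx m} (h : Function.Injective
      (Fin.cons (α := fun _ => Idx m) a (Fin.cons (α := fun _ => Idx m) b ν))) :
    permSign (Fin.cons (α := fun _ => Idx m) a (Fin.cons (α := fun _ => Idx m) b ν))
      * permSign (Fin.cons (α := fun _ => Idx m) c (Fin.cons (α := fun _ => Idx m) d ν))
    = (if a = c then 1 else 0) * (if b = d then 1 else 0)
      - (if a = d then 1 else 0) * (if b = c then 1 else 0) := by
  have hne : a ≠ b := fun h' => by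
    have := @h 0 (Fin.succ 0) (by simpa using h')
    exact absurd this (Fin.succ_ne_zero _).symm
  by_cases h1 : a = c ∧ b = d
  · obtain ⟨rfl, rfl⟩ := h1
    rw [permSign_mul_self hs h]
    simp [hne]
  by_cases h2 : a = d ∧ b = c
  · obtain ⟨rfl, rfl⟩ := h2
    rw [permSign_swap b a, mul_neg, permSign_mul_self hs h]
    simp [hne]
  have hr : ((if a = c then 1 else 0) * (if b = d then 1 else 0)
      - (if a = d then 1 else 0) * (if b = c then 1 else 0) : ℝ) = 0 := by
    grind
  rw [hr, permSign_eq_zero (f := Fin.cons (α := fun _ => Idx m) c _), mul_zero]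
  intro h3
  have hx (x : Idx m) : x = a ∨ x = b ∨ x ∈ Set.range ν := by
    obtain ⟨i, hi⟩ := (bijective_of_injective_idx hs h).2 x
    revert hi
    refine Fin.cases ?_ (fun i => Fin.cases ?_ (fun i => ?_) i) i
    · exact fun h' => Or.inl h'.symm
    · exact fun h' => Or.inr (Or.inl h'.symm)
    · exact fun h' => Or.inr (Or.inr ⟨i, h'⟩)
  rw [Fin.cons_injective_iff, Fin.cons_injective_iff, Fin.range_cons, Set.mem_insert_iff,
    not_or] at h3
  have hc := hx c
  have hd := hx d
  have h31 := h3.1.1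
  have h32 := h3.1.2
  have h33 := h3.2.1
  grind

/-- The contraction of two Levi-Civita symbols over all but two indices. For `a ≠ b`, each of the
`s!` completions contributes the same value. -/
theorem sum_permSign_mul_permSign {s : ℕ} (hs : s + 2 = dim m) (a b c d : Idx m) :
    ∑ ν : Fin s → Idx m,
      permSign (Fin.cons (α := fun _ => Idx m) a (Fin.cons (α := fun _ => Idx m) b ν))
      * permSign (Fin.cons (α := fun _ => Idx m) c (Fin.cons (α := fun _ => Idx m) d ν))
    = (s.factorial : ℝ) * ((if a = c then 1 else 0) * (if b = d then 1 else 0)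
      - (if a = d then 1 else 0) * (if b = c then 1 else 0)) := by
  classical
  have h (ν : Fin s → Idx m) :
      permSign (Fin.cons (α := fun _ => Idx m) a (Fin.cons (α := fun _ => Idx m) b ν))
      * permSign (Fin.cons (α := fun _ => Idx m) c (Fin.cons (α := fun _ => Idx m) d ν))
      = if Function.Injective
          (Fin.cons (α := fun _ => Idx m) a (Fin.cons (α := fun _ => Idx m) b ν))
        then ((if a = c then 1 else 0) * (if b = d then 1 else 0)
          - (if a = d then 1 else 0) * (if b = c then 1 else 0)) else 0 := by
    by_cases hi : Function.Injective
      (Fin.cons (α := fun _ => Idx m) a (Fin.cons (α := fun _ => Idx m) b ν))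
    · rw [if_pos hi, permSign_mul_permSign hs c d hi]
    · rw [if_neg hi, permSign_eq_zero hi, zero_mul]
  simp only [h]
  rw [← Finset.sum_filter, Finset.sum_const, ← Fintype.card_subtype, nsmul_eq_mul]
  by_cases hab : a = b
  · subst hab
    rw [mul_comm (if a = d then (1 : ℝ) else 0), sub_self, mul_zero, mul_zero]
  · congr 2
    convert card_injective_cons_cons hs hab

/-- Used to pull the metric signs out of the sum over `ν`: on a full list the product of all signs
is `η a * η b * ∏ η (ν j)`, and `η b ^ 2 = 1`. On other lists `permSign` vanishes. -/
theorem prod_eta_mul_permSign {s : ℕ} (hs : s + 2 = dim m) {η : Idx m → ℝ}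
    (hη : ∀ α, η α = 1 ∨ η α = -1) (a b : Idx m) (ν : Fin s → Idx m) :
    (η a * ∏ j, η (ν j))
      * permSign (Fin.cons (α := fun _ => Idx m) a (Fin.cons (α := fun _ => Idx m) b ν))
    = (η b * ∏ μ, η μ)
      * permSign (Fin.cons (α := fun _ => Idx m) a (Fin.cons (α := fun _ => Idx m) b ν)) := by
  by_cases hi : Function.Injective
      (Fin.cons (α := fun _ => Idx m) a (Fin.cons (α := fun _ => Idx m) b ν))
  · congr 1
    rw [← (bijective_of_injective_idx hs hi).prod_comp, Fin.prod_univ_succ, Fin.prod_univ_succ]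
    simp only [Fin.cons_zero, Fin.cons_succ]
    have hb : η b * η b = 1 := by rcases hη b with h | h <;> simp [h]
    linear_combination -(η a * ∏ j, η (ν j)) * hb
  · rw [permSign_eq_zero hi, mul_zero, mul_zero]

/-- Summing an antisymmetric function of lists against the generalized Kronecker symbol. -/
theorem sum_mul_det_kronecker {I : Type*} [Fintype I] [DecidableEq I] {k : ℕ}
    (φ : (Fin k → I) → ℝ)
    (hφ : ∀ ρ (π : Equiv.Perm (Fin k)), φ (ρ ∘ π) = (Equiv.Perm.sign π : ℝ) * φ ρ)
    (κ : Fin k → I) :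
    ∑ ρ : Fin k → I, φ ρ * Matrix.det (Matrix.of fun j i => if κ i = ρ j then (1 : ℝ) else 0)
      = (k.factorial : ℝ) * φ κ := by
  -- In the Leibniz expansion the term of `π` survives only for the one list `ρ = κ ∘ π⁻¹`, and each
  -- `π` then contributes `φ κ`.
  have h1 (ρ : Fin k → I) (π : Equiv.Perm (Fin k)) :
      (∏ i, if κ i = ρ (π i) then (1 : ℝ) else 0) = if ρ = κ ∘ π.symm then 1 else 0 := by
    by_cases h : ρ = κ ∘ π.symm
    · subst h
      simp
    · rw [if_neg h]
      by_contra hne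
      apply h
      ext1 j
      have := Finset.prod_ne_zero_iff.1 hne (π.symm j) (Finset.mem_univ _)
      simp only [Equiv.apply_symm_apply, ne_eq, ite_eq_right_iff, one_ne_zero, imp_false,
        not_not] at this
      exact this.symm
  simp only [Matrix.det_apply', Matrix.of_apply, h1, Finset.mul_sum]
  rw [Finset.sum_comm]
  have h2 (π : Equiv.Perm (Fin k)) :
      ∑ ρ : Fin k → I, φ ρ * ((Equiv.Perm.sign π : ℝ) * if ρ = κ ∘ π.symm then 1 else 0)
        = φ κ := by
    rw [Finset.sum_eq_single (κ ∘ π.symm) (fun ρ _ h => by simp [h]) (by simp), if_pos rfl, hφ]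
    have : (Equiv.Perm.sign π : ℝ) * (Equiv.Perm.sign π : ℝ) = 1 := by
      rw [← Int.cast_mul, ← Units.val_mul, Int.units_mul_self]
      simp
    rw [Equiv.Perm.sign_symm]
    linear_combination φ κ * this
  simp only [h2]
  simp [Fintype.card_perm]

end PermSign

end HaGravity

namespace HaGravity

/-! ### Exterior algebra -/

section HodgeContraction

variable {z : ℕ} {m : Fin (z + 1) → ℕ}

theorem oneForm_apply (α : Coord m →L[ℝ] ℝ) (v : Fin 1 → Coord m) : oneForm α v = α (v 0) := rfl

theorem wedge_apply {r : ℕ} (α : Coord m →L[ℝ] ℝ) (β : Form m r) (v : Fin (r + 1) → Coord m) :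
    wedge α β v = ∑ i : Fin (r + 1), (-1) ^ (i : ℕ) * (α (v i) * β (i.removeNth v)) := by
  simp [wedge, ContinuousAlternatingMap.alternatizeUncurryFin_apply, zsmul_eq_mul]

theorem wedgeCovectors_apply {s : ℕ} (e : Fin s → Coord m →L[ℝ] ℝ) (w : Fin s → Coord m) :
    wedgeCovectors e w = Matrix.det (Matrix.of fun j i => e i (w j)) := rfl

theorem wedgeCovectors_one (e : Fin 1 → Coord m →L[ℝ] ℝ) : wedgeCovectors e = oneForm (e 0) := by
  ext w
  rw [wedgeCovectors_apply, oneForm_apply, Matrix.det_fin_one]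
  rfl

/-- This is Laplace expansion of the determinant along its first column. -/
theorem wedge_wedgeCovectors {s : ℕ} (α : Coord m →L[ℝ] ℝ) (e : Fin s → Coord m →L[ℝ] ℝ) :
    wedge α (wedgeCovectors e) = wedgeCovectors (Fin.cons (α := fun _ => Coord m →L[ℝ] ℝ) α e) := by
  ext w
  rw [wedge_apply, wedgeCovectors_apply, Matrix.det_succ_column_zero]
  refine Finset.sum_congr rfl fun i _ => ?_
  rw [wedgeCovectors_apply, mul_assoc]
  rfl

theorem wedge_add {r : ℕ} (α : Coord m →L[ℝ] ℝ) (β γ : Form m r) :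
    wedge α (β + γ) = wedge α β + wedge α γ := by
  ext w
  simp only [wedge_apply, ContinuousAlternatingMap.add_apply, mul_add, Finset.sum_add_distrib]

theorem wedge_smul {r : ℕ} (α : Coord m →L[ℝ] ℝ) (c : ℝ) (β : Form m r) :
    wedge α (c • β) = c • wedge α β := by
  ext w
  simp only [wedge_apply, ContinuousAlternatingMap.smul_apply, smul_eq_mul, Finset.mul_sum]
  exact Finset.sum_congr rfl fun i _ => by ring

theorem add_wedge {r : ℕ} (α α' : Coord m →L[ℝ] ℝ) (β : Form m r) :
    wedge (α + α') β = wedge α β + wedge α' β := by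
  ext w
  simp only [wedge_apply, ContinuousAlternatingMap.add_apply, add_apply, add_mul, mul_add,
    Finset.sum_add_distrib]

theorem smul_wedge {r : ℕ} (c : ℝ) (α : Coord m →L[ℝ] ℝ) (β : Form m r) :
    wedge (c • α) β = c • wedge α β := by
  ext w
  simp only [wedge_apply, ContinuousAlternatingMap.smul_apply, smul_apply, smul_eq_mul,
    Finset.mul_sum]
  exact Finset.sum_congr rfl fun i _ => by ring

theorem wedge_zero {r : ℕ} (α : Coord m →L[ℝ] ℝ) : wedge α (0 : Form m r) = 0 := by
  simpa using wedge_smul α 0 (0 : Form m r)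

theorem zero_wedge {r : ℕ} (β : Form m r) : wedge (0 : Coord m →L[ℝ] ℝ) β = 0 := by
  simpa using smul_wedge 0 (0 : Coord m →L[ℝ] ℝ) β

theorem wedge_sum {r : ℕ} {J : Type*} (t : Finset J) (α : Coord m →L[ℝ] ℝ) (β : J → Form m r) :
    wedge α (∑ j ∈ t, β j) = ∑ j ∈ t, wedge α (β j) :=
  map_sum (AddMonoidHom.mk' (wedge α) (wedge_add α)) β t

theorem sum_wedge {r : ℕ} {J : Type*} (t : Finset J) (α : J → Coord m →L[ℝ] ℝ) (β : Form m r) :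
    wedge (∑ j ∈ t, α j) β = ∑ j ∈ t, wedge (α j) β :=
  map_sum (AddMonoidHom.mk' (fun a => wedge a β) fun a b => add_wedge a b β) α t

theorem wedge_oneForm_apply (α β : Coord m →L[ℝ] ℝ) (X Y : Coord m) :
    wedge α (oneForm β) ![X, Y] = α X * β Y - α Y * β X := by
  rw [wedge_apply, Fin.sum_univ_two]
  simp [oneForm_apply, Fin.removeNth]
  ring

theorem form_two_ext {β γ : Form m 2} (h : ∀ X Y, β ![X, Y] = γ ![X, Y]) : β = γ := by
  ext v
  rw [show v = ![v 0, v 1] by ext1 i; fin_cases i <;> rfl]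
  exact h _ _

theorem form_two_swap (β : Form m 2) (X Y : Coord m) : β ![X, Y] = -β ![Y, X] := by
  have h := β.toAlternatingMap.map_swap ![Y, X] (show (0 : Fin 2) ≠ 1 by simp)
  refine Eq.trans (congrArg β ?_) h
  ext1 i
  fin_cases i <;> simp

theorem wedge_oneForm_swap (α β : Coord m →L[ℝ] ℝ) :
    wedge α (oneForm β) = -wedge β (oneForm α) := by
  refine form_two_ext fun X Y => ?_
  rw [ContinuousAlternatingMap.neg_apply, wedge_oneForm_apply, wedge_oneForm_apply]
  ring

theorem hodge_add (e : Idx m → Coord m →L[ℝ] ℝ) (X : Idx m → Coord m) (η : Idx m → ℝ) (r s : ℕ)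
    (β γ : Form m r) : hodge e X η r s (β + γ) = hodge e X η r s β + hodge e X η r s γ := by
  simp only [hodge, ContinuousAlternatingMap.add_apply, mul_add, add_smul, Finset.sum_add_distrib,
    smul_add]

theorem hodge_smul (e : Idx m → Coord m →L[ℝ] ℝ) (X : Idx m → Coord m) (η : Idx m → ℝ) (r s : ℕ)
    (c : ℝ) (β : Form m r) : hodge e X η r s (c • β) = c • hodge e X η r s β := by
  simp only [hodge, ContinuousAlternatingMap.smul_apply, smul_eq_mul, Finset.smul_sum, smul_smul]
  refine Finset.sum_congr rfl fun μ _ => Finset.sum_congr rfl fun ν _ => ?_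
  congr 1
  ring

theorem hodgeInv_add (e : Idx m → Coord m →L[ℝ] ℝ) (X : Idx m → Coord m) (η : Idx m → ℝ)
    (r s : ℕ) (β γ : Form m r) :
    hodgeInv e X η r s (β + γ) = hodgeInv e X η r s β + hodgeInv e X η r s γ := by
  simp only [hodgeInv, hodge_add, smul_add]

theorem hodgeInv_smul (e : Idx m → Coord m →L[ℝ] ℝ) (X : Idx m → Coord m) (η : Idx m → ℝ)
    (r s : ℕ) (c : ℝ) (β : Form m r) :
    hodgeInv e X η r s (c • β) = c • hodgeInv e X η r s β := by
  simp only [hodgeInv, hodge_smul, smul_comm c]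

variable {e : Idx m → Coord m →L[ℝ] ℝ} {X : Idx m → Coord m} {η : Idx m → ℝ}

/-- On frame vectors the determinant defining `e^l ∧ e^ν` becomes a generalized Kronecker symbol,
ready for `sum_mul_det_kronecker`. -/
theorem wedge_hodge_apply_frame {s : ℕ} (hdual : ∀ α β, e α (X β) = if α = β then 1 else 0)
    (l : Idx m) (β : Form m 2) (ρ : Fin (s + 1) → Idx m) :
    wedge (e l) (hodge e X η 2 s β) (fun i => X (ρ i))
      = (2 * (s.factorial : ℝ))⁻¹ * ∑ μ : Fin 2 → Idx m, ∑ ν : Fin s → Idx m,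
        ((∏ j, η (ν j)) * permSign (Fin.append μ ν) * β (fun i => X (μ i)))
        * Matrix.det (Matrix.of fun j i =>
            if (Fin.cons (α := fun _ => Idx m) l ν) i = ρ j then (1 : ℝ) else 0) := by
  simp only [hodge, wedge_smul, wedge_sum, wedge_wedgeCovectors]
  have hcons (ν : Fin s → Idx m) (j i : Fin (s + 1)) :
      (Fin.cons (α := fun _ => Coord m →L[ℝ] ℝ) (e l) fun k => e (ν k)) i (X (ρ j))
        = if (Fin.cons (α := fun _ => Idx m) l ν) i = ρ j then (1 : ℝ) else 0 := by
    refine Fin.cases ?_ (fun i => ?_) i <;> simp [hdual]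
  simp only [ContinuousAlternatingMap.smul_apply, ContinuousAlternatingMap.sum_apply,
    wedgeCovectors_apply, smul_eq_mul, hcons]
  simp

/-- `*(e^l ∧ *β)` is a contraction of the 2-form `β`. -/
theorem hodge_wedge_hodge {s : ℕ} (hs : s + 2 = dim m)
    (hdual : ∀ α β, e α (X β) = if α = β then 1 else 0) (hη : ∀ α, η α = 1 ∨ η α = -1)
    (l : Idx m) (β : Form m 2) :
    hodge e X η (s + 1) 1 (wedge (e l) (hodge e X η 2 s β))
      = ∑ σ, ((-1) ^ s * (η l * ∏ μ, η μ) * β ![X l, X σ]) • oneForm (e σ) := by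
  rw [hodge, Finset.sum_comm, Finset.smul_sum,
    ← (Equiv.funUnique (Fin 1) (Idx m)).symm.sum_comp]
  refine Finset.sum_congr rfl fun σ _ => ?_
  simp only [wedgeCovectors_one, ← Finset.sum_smul, smul_smul]
  congr 1
  have hσ (i : Fin 1) : (Equiv.funUnique (Fin 1) (Idx m)).symm σ i = σ := rfl
  simp only [hσ, permSign_append_one, wedge_hodge_apply_frame hdual, Finset.univ_unique,
    Finset.prod_const, Finset.card_singleton, pow_one, Nat.factorial_one, Nat.cast_one, mul_one]
  have h1 (μ : Fin 2 → Idx m) (ν : Fin s → Idx m) :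
      ∑ ρ : Fin (s + 1) → Idx m, permSign (Fin.cons (α := fun _ => Idx m) σ ρ)
        * Matrix.det (Matrix.of fun j i =>
            if (Fin.cons (α := fun _ => Idx m) l ν) i = ρ j then (1 : ℝ) else 0)
      = ((s + 1).factorial : ℝ) * permSign (Fin.cons (α := fun _ => Idx m) σ
          (Fin.cons (α := fun _ => Idx m) l ν)) :=
    sum_mul_det_kronecker _ (fun ρ π => permSign_cons_comp_perm σ ρ π) _
  -- Three sums collapse in turn: over `ρ` by antisymmetry (factor `(s+1)!`), over `ν` by
  -- contracting sign symbols (factor `s!`), over `μ` by Kronecker deltas. The factorials cancel the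
  -- Hodge normalizations, and the two surviving terms combine to `-2 β(X l, X σ)`, cancelling the
  -- remaining `1/2`.
  have h2 : ∑ ρ : Fin (s + 1) → Idx m, η σ * ((-1) ^ (s + 1)
        * permSign (Fin.cons (α := fun _ => Idx m) σ ρ))
        * ((2 * (s.factorial : ℝ))⁻¹ * ∑ μ : Fin 2 → Idx m, ∑ ν : Fin s → Idx m,
        ((∏ j, η (ν j)) * permSign (Fin.append μ ν) * β (fun i => X (μ i)))
        * Matrix.det (Matrix.of fun j i =>
            if (Fin.cons (α := fun _ => Idx m) l ν) i = ρ j then (1 : ℝ) else 0))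
      = (2 * (s.factorial : ℝ))⁻¹ * (-1) ^ (s + 1) * ((s + 1).factorial : ℝ)
        * ((η l * ∏ μ, η μ) * ((s.factorial : ℝ) * (β ![X σ, X l] - β ![X l, X σ]))) := by
    have h3 (μ : Fin 2 → Idx m) : ∑ ν : Fin s → Idx m,
        permSign (Fin.cons (α := fun _ => Idx m) σ (Fin.cons (α := fun _ => Idx m) l ν))
          * permSign (Fin.append μ ν)
        = (s.factorial : ℝ) * ((if σ = μ 0 then 1 else 0) * (if l = μ 1 then 1 else 0)
          - (if σ = μ 1 then 1 else 0) * (if l = μ 0 then 1 else 0)) := by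
      simp only [permSign_append_two]
      exact sum_permSign_mul_permSign hs _ _ _ _
    have h4 : ∑ μ : Fin 2 → Idx m, β (fun i => X (μ i))
          * ((s.factorial : ℝ) * ((if σ = μ 0 then 1 else 0) * (if l = μ 1 then 1 else 0)
          - (if σ = μ 1 then 1 else 0) * (if l = μ 0 then 1 else 0)))
        = (s.factorial : ℝ) * (β ![X σ, X l] - β ![X l, X σ]) := by
      rw [← (finTwoArrowEquiv (Idx m)).symm.sum_comp, Fintype.sum_prod_type]
      have hX (a b : Idx m) :
          (fun i => X (![a, b] i)) = ![X a, X b] := by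
        ext1 i
        fin_cases i <;> rfl
      simp only [finTwoArrowEquiv_symm_apply, hX, Matrix.cons_val_zero, Matrix.cons_val_one,
        mul_sub, Finset.sum_sub_distrib]
      congr 1
      · rw [Finset.sum_eq_single σ (fun a _ h => by simp [h.symm]) (by simp),
          Finset.sum_eq_single l (fun a _ h => by simp [h.symm]) (by simp)]
        simp [mul_comm]
      · rw [Finset.sum_eq_single l (fun a _ h => by simp [h.symm]) (by simp),
          Finset.sum_eq_single σ (fun a _ h => by simp [h.symm]) (by simp)]
        simp [mul_comm]
    rw [← h4]
    simp only [Finset.mul_sum, ← h3]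
    rw [Finset.sum_comm]
    refine Finset.sum_congr rfl fun μ _ => ?_
    rw [Finset.sum_comm]
    refine Finset.sum_congr rfl fun ν _ => ?_
    have h5 := prod_eta_mul_permSign hs hη σ l ν
    calc _ = (2 * (s.factorial : ℝ))⁻¹ * (-1) ^ (s + 1) * (η σ * ∏ j, η (ν j))
          * permSign (Fin.append μ ν) * β (fun i => X (μ i))
          * ∑ ρ : Fin (s + 1) → Idx m, permSign (Fin.cons (α := fun _ => Idx m) σ ρ)
            * Matrix.det (Matrix.of fun j i =>
              if (Fin.cons (α := fun _ => Idx m) l ν) i = ρ j then (1 : ℝ) else 0) := by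
          rw [Finset.mul_sum]
          exact Finset.sum_congr rfl fun ρ _ => by ring
      _ = _ := by
          rw [h1 μ ν]
          linear_combination (2 * (s.factorial : ℝ))⁻¹ * (-1) ^ (s + 1) * ((s + 1).factorial : ℝ)
            * permSign (Fin.append μ ν) * β (fun i => X (μ i)) * h5
  rw [h2, form_two_swap β (X σ) (X l)]
  have hf : (s.factorial : ℝ) ≠ 0 := by positivity
  have hf' : ((s + 1).factorial : ℝ) ≠ 0 := by positivity
  field_simp
  ring

/-- The prefactor `(∏ η)(-1)^(s+1)` of `*⁻¹` cancels both `∏ η` and `(-1)^s`, leaving a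
dimension-independent minus sign. -/
theorem hodgeInv_wedge_hodge {s : ℕ} (hs : s + 2 = dim m)
    (hdual : ∀ α β, e α (X β) = if α = β then 1 else 0) (hη : ∀ α, η α = 1 ∨ η α = -1)
    (l : Idx m) (β : Form m 2) :
    hodgeInv e X η (s + 1) 1 (wedge (e l) (hodge e X η 2 s β))
      = ∑ σ, (-(η l * β ![X l, X σ])) • oneForm (e σ) := by
  rw [hodgeInv, hodge_wedge_hodge hs hdual hη, Finset.smul_sum]
  refine Finset.sum_congr rfl fun σ _ => ?_
  rw [smul_smul]
  congr 1
  have h1 : (∏ μ, η μ) * (∏ μ, η μ) = 1 := by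
    rw [← Finset.prod_mul_distrib]
    exact Finset.prod_eq_one fun μ _ => by rcases hη μ with h | h <;> simp [h]
  have h2 : ((-1 : ℝ) ^ s) * (-1) ^ s = 1 := by rw [← mul_pow]; simp
  rw [mul_one, pow_succ]
  linear_combination (-(-1 : ℝ) ^ s * (-1) ^ s * η l * β ![X l, X σ]) * h1
    - η l * β ![X l, X σ] * h2

end HodgeContraction

end HaGravity

namespace HaGravity

variable {z : ℕ} {m : Fin (z + 1) → ℕ}

/-! ### Adapted frames and the curvature matrix -/

namespace HaData

variable {H : HaData m} {U : Set (Coord m)} {u : Coord m}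

/-- `N` is strictly block triangular with respect to the shells, so `1 - N` is unipotent. -/
theorem IsHa.det_frameMatrix (h : H.IsHa U) (hu : u ∈ U) : (H.frameMatrix u).det = 1 := by
  have ht : (H.frameMatrix u).BlockTriangular (fun a : Idx m => a.1) := fun i j hij => by
    have hne : i ≠ j := fun h' => by simp [h'] at hij
    simp [frameMatrix, hne, h.N_shell u hu i j (not_lt.2 hij.le)]
  rw [ht.det_fintype]
  refine Finset.prod_eq_one fun p _ => ?_
  convert Matrix.det_one (R := ℝ) (n := {a : Idx m // a.1 = p})
  ext i j
  have hN := h.N_shell u hu i.1 j.1 (by rw [i.2, j.2]; exact lt_irrefl _)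
  simp [Matrix.toSquareBlock, Matrix.toSquareBlockProp, frameMatrix, hN, Matrix.one_apply,
    Subtype.ext_iff]

theorem IsHa.isUnit_frameMatrix (h : H.IsHa U) (hu : u ∈ U) : IsUnit (H.frameMatrix u).det := by
  rw [h.det_frameMatrix hu]; exact isUnit_one

theorem coframe_apply (H : HaData m) (β : Idx m) (u v : Coord m) :
    H.coframe β u v = ∑ a, (H.frameMatrix u)⁻¹ a β * v a := by
  simp [coframe]

theorem IsHa.coframe_frame (h : H.IsHa U) (hu : u ∈ U) (α β : Idx m) :
    H.coframe β u (H.frame α u) = if α = β then 1 else 0 := by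
  have h1 := congrFun (congrFun (Matrix.mul_nonsing_inv _ (h.isUnit_frameMatrix hu)) α) β
  rw [Matrix.mul_apply, Matrix.one_apply] at h1
  rw [coframe_apply, ← h1]
  exact Finset.sum_congr rfl fun a _ => mul_comm _ _

theorem IsHa.sum_coframe_smul_frame (h : H.IsHa U) (hu : u ∈ U) (v : Coord m) :
    ∑ β, H.coframe β u v • H.frame β u = v := by
  ext b
  have h1 (a : Idx m) := congrFun (congrFun
    (Matrix.nonsing_inv_mul _ (h.isUnit_frameMatrix hu)) a) b
  simp only [Matrix.mul_apply, Matrix.one_apply] at h1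
  simp only [Finset.sum_apply, Pi.smul_apply, smul_eq_mul, coframe_apply, Finset.sum_mul, frame]
  rw [Finset.sum_comm]
  calc _ = ∑ a, v a * ∑ β, (H.frameMatrix u)⁻¹ a β * H.frameMatrix u β b := by
        refine Finset.sum_congr rfl fun a _ => ?_
        rw [Finset.mul_sum]
        exact Finset.sum_congr rfl fun β _ => by ring
    _ = v b := by simp [h1]

theorem IsHa.sum_coframe_mul_apply_frame (h : H.IsHa U) (hu : u ∈ U) (L : Coord m →L[ℝ] ℝ)
    (v : Coord m) : ∑ β, L (H.frame β u) * H.coframe β u v = L v := by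
  conv_rhs => rw [← h.sum_coframe_smul_frame hu v, map_sum]
  exact Finset.sum_congr rfl fun β _ => by rw [map_smul, smul_eq_mul, mul_comm]

theorem IsHa.matSmoothOn_frameMatrix (h : H.IsHa U) : MatSmoothOn U H.frameMatrix :=
  fun a b => contDiffOn_const.sub (h.N_smooth a b)

theorem IsHa.matSmoothOn_frameMatrix_inv (h : H.IsHa U) :
    MatSmoothOn U fun v => (H.frameMatrix v)⁻¹ :=
  h.matSmoothOn_frameMatrix.inv fun v hv => by rw [h.det_frameMatrix hv]; exact one_ne_zero

theorem IsHa.contDiffOn_coframe_apply (h : H.IsHa U) (β : Idx m) (X : Coord m) :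
    ContDiffOn ℝ ∞ (fun v => H.coframe β v X) U := by
  simp only [coframe_apply]
  exact ContDiffOn.sum fun a _ => (h.matSmoothOn_frameMatrix_inv a β).mul contDiffOn_const

/-- The matrix of the connection form on the vector `X`, in the frame `δ_α`. -/
noncomputable def connMat (H : HaData m) (X v : Coord m) : Matrix (Idx m) (Idx m) ℝ :=
  Matrix.of fun α β => ∑ γ, H.Γ α β γ v * H.coframe γ v X

theorem IsHa.matSmoothOn_connMat (h : H.IsHa U) (X : Coord m) : MatSmoothOn U (H.connMat X) :=
  fun α β => ContDiffOn.sum fun γ _ => (h.Γ_smooth α β γ).mul (h.contDiffOn_coframe_apply γ X)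

theorem IsHa.connMat_frame (h : H.IsHa U) (hu : u ∈ U) (α β γ : Idx m) :
    H.connMat (H.frame γ u) u α β = H.Γ α β γ u := by
  simp [connMat, h.coframe_frame hu]

/-- This is `Dg = 0` in an arbitrary direction, in the matrix form required by `curvMat_skew`. -/
theorem IsHa.dMat_metricMatrix (h : H.IsHa U) (hu : u ∈ U) (X : Coord m) :
    dMat H.metricMatrix X u
      = (H.connMat X u).transpose * H.metricMatrix u + H.metricMatrix u * H.connMat X u := by
  ext α β
  have h1 (γ : Idx m) : H.del γ (H.g α β) u
      = ∑ φ, H.Γ φ α γ u * H.g φ β u + ∑ φ, H.Γ φ β γ u * H.g α φ u := by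
    have := h.metric_compat u hu γ α β
    unfold covMetric at this
    linarith
  have h2 := h.sum_coframe_mul_apply_frame hu (fderiv ℝ (H.g α β) u) X
  change fderiv ℝ (H.g α β) u X = _
  rw [← h2]
  change ∑ γ, H.del γ (H.g α β) u * _ = _
  simp only [h1, Matrix.add_apply, Matrix.mul_apply, Matrix.transpose_apply, connMat,
    Matrix.of_apply, metricMatrix, add_mul, Finset.sum_add_distrib, Finset.sum_mul, Finset.mul_sum]
  congr 1
  · rw [Finset.sum_comm]
    exact Finset.sum_congr rfl fun φ _ => Finset.sum_congr rfl fun γ _ => by ring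
  · rw [Finset.sum_comm]
    exact Finset.sum_congr rfl fun φ _ => Finset.sum_congr rfl fun γ _ => by ring

/-- The vector `H.frame γ u` is frozen at `u`. Since the full pairing of coframe and frame is
constant, the derivative of the coframe can be moved to the frame with a minus sign. -/
theorem IsHa.fderiv_coframe_apply (h : H.IsHa U) (hU : IsOpen U) (hu : u ∈ U) (φ γ : Idx m)
    (X : Coord m) :
    fderiv ℝ (fun v => H.coframe φ v (H.frame γ u)) u X
      = -H.coframe φ u (fderiv ℝ (H.frame γ) u X) := by
  have hF := h.matSmoothOn_frameMatrix
  have hI := h.matSmoothOn_frameMatrix_inv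
  have h1 : dMat (fun v => H.frameMatrix v * (H.frameMatrix v)⁻¹) X u = 0 := by
    rw [dMat_congr (G := fun _ => 1)
      (fun v hv => Matrix.mul_nonsing_inv _ (h.isUnit_frameMatrix hv)) hU hu]
    ext a b
    simp [dMat]
  rw [dMat_mul hF hI hU hu] at h1
  have h2 := congrFun (congrFun h1 γ) φ
  simp only [Matrix.add_apply, Matrix.mul_apply, Matrix.zero_apply, dMat, Matrix.of_apply] at h2
  have h3 : fderiv ℝ (fun v => H.coframe φ v (H.frame γ u)) u X
      = ∑ a, H.frameMatrix u γ a * fderiv ℝ (fun v => (H.frameMatrix v)⁻¹ a φ) u X := by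
    simp only [coframe_apply]
    rw [fderiv_fun_sum fun a _ => (hI.differentiableAt hU hu a φ).mul_const _, sum_apply]
    refine Finset.sum_congr rfl fun a _ => ?_
    rw [fderiv_mul_const (hI.differentiableAt hU hu a φ)]
    rfl
  have h4 (a : Idx m) : fderiv ℝ (H.frame γ) u X a
      = fderiv ℝ (fun v => H.frameMatrix v γ a) u X := by
    rw [fderiv_pi (φ := fun a v => H.frame γ v a) fun a => hF.differentiableAt hU hu γ a]
    rfl
  rw [h3, coframe_apply, eq_neg_iff_add_eq_zero, ← h2, add_comm]
  congr 1
  exact Finset.sum_congr rfl fun a _ => by rw [h4, mul_comm]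

/-- `curvMat` uses constant vector fields, whereas `curv` uses the moving frame. The correction term
here, antisymmetrized in `γ` and `τ`, supplies the anholonomy term of `curv`. -/
theorem IsHa.dMat_connMat_frame (h : H.IsHa U) (hU : IsOpen U) (hu : u ∈ U) (α β γ τ : Idx m) :
    dMat (H.connMat (H.frame γ u)) (H.frame τ u) u α β
      = H.del τ (H.Γ α β γ) u
        - ∑ φ, H.Γ α β φ u * H.coframe φ u (fderiv ℝ (H.frame γ) u (H.frame τ u)) := by
  have hΓ (φ : Idx m) : DifferentiableAt ℝ (H.Γ α β φ) u :=
    ((h.Γ_smooth α β φ).contDiffAt (hU.mem_nhds hu)).differentiableAt (by simp)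
  have hc (φ : Idx m) : DifferentiableAt ℝ (fun v => H.coframe φ v (H.frame γ u)) u :=
    ((h.contDiffOn_coframe_apply φ _).contDiffAt (hU.mem_nhds hu)).differentiableAt (by simp)
  change fderiv ℝ (fun v => ∑ φ, H.Γ α β φ v * H.coframe φ v (H.frame γ u)) u _ = _
  rw [fderiv_fun_sum fun φ _ => (hΓ φ).fun_mul (hc φ), sum_apply]
  simp only [fderiv_fun_mul (hΓ _) (hc _), add_apply, smul_apply, smul_eq_mul,
    h.fderiv_coframe_apply hU hu, h.coframe_frame hu, Finset.sum_add_distrib]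
  simp [del, add_comm, sub_eq_add_neg]

/-- The components of the curvature matrix in the adapted frame. -/
theorem IsHa.curvMat_frame (h : H.IsHa U) (hU : IsOpen U) (hu : u ∈ U) (α β γ τ : Idx m) :
    curvMat H.connMat (H.frame τ u) (H.frame γ u) u α β = H.curv β α γ τ u := by
  simp only [curvMat, Matrix.sub_apply, Matrix.add_apply, Matrix.mul_apply,
    h.dMat_connMat_frame hU hu, h.connMat_frame hu, curv, anholonomy, VectorField.lieBracket,
    map_sub, mul_sub, Finset.sum_sub_distrib]
  simp only [mul_comm (H.Γ α _ _ u) (H.Γ _ β _ u)]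
  ring

theorem IsHa.curv_skew (h : H.IsHa U) (hU : IsOpen U) (hu : u ∈ U) (X Y : Coord m) :
    curvMat H.connMat X Y u * (H.metricMatrix u)⁻¹
      = -((H.metricMatrix u)⁻¹ * (curvMat H.connMat X Y u).transpose) := by
  have h1 := curvMat_skew h.matSmoothOn_connMat (g := H.metricMatrix) (fun a b => h.g_smooth a b)
    hU hu (fun v hv X => h.dMat_metricMatrix hv X) X Y
  have hd : IsUnit (H.metricMatrix u).det := isUnit_iff_ne_zero.2 (h.g_nondeg u hu)
  have h2 := congrArg (fun M => (H.metricMatrix u)⁻¹ * M * (H.metricMatrix u)⁻¹) h1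
  simp only [mul_add, add_mul, mul_zero, zero_mul] at h2
  rw [mul_assoc, mul_assoc _ (H.metricMatrix u), Matrix.mul_nonsing_inv _ hd, mul_one,
    ← mul_assoc _ (H.metricMatrix u), Matrix.nonsing_inv_mul _ hd, one_mul] at h2
  exact eq_neg_of_add_eq_zero_right h2

theorem curv_swap (H : HaData m) (β α γ τ : Idx m) (u : Coord m) :
    H.curv β α γ τ u = -H.curv β α τ γ u := by
  have h1 (φ : Idx m) : H.anholonomy φ γ τ u = -H.anholonomy φ τ γ u := by
    rw [anholonomy, VectorField.lieBracket_swap, map_neg, anholonomy]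
  simp only [curv, h1, mul_neg, Finset.sum_neg_distrib]
  ring

/-- The curvature preserves the splitting into horizontal and vertical vectors. -/
theorem IsHa.curv_eq_zero (h : H.IsHa U) (hU : IsOpen U) (hu : u ∈ U) {α β : Idx m}
    (hαβ : ¬ (α.1 = 0 ↔ β.1 = 0)) (γ τ : Idx m) : H.curv β α γ τ u = 0 := by
  have h1 (γ τ : Idx m) : H.del τ (H.Γ α β γ) u = 0 := by
    have : H.Γ α β γ =ᶠ[nhds u] fun _ => 0 := by
      filter_upwards [hU.mem_nhds hu] with v hv
      exact h.Γ_hv v hv α β γ hαβ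
    rw [del, this.fderiv_eq]
    simp
  have h2 (γ τ φ : Idx m) : H.Γ φ β γ u * H.Γ α φ τ u = 0 := by
    by_cases hφ : φ.1 = 0 ↔ β.1 = 0
    · rw [h.Γ_hv u hu α φ τ (by tauto), mul_zero]
    · rw [h.Γ_hv u hu φ β γ hφ, zero_mul]
  simp [curv, h1, h2, h.Γ_hv u hu α β _ hαβ]

end HaData

/-! ### Curvature forms -/

/-- The two halves of `[θ, θ]` agree on 1-forms, so `½ [θ, θ]` evaluates to the matrix commutator.
-/
theorem curvatureForm_apply {κ : Type} [Fintype κ]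
    {θ : Coord m → Matrix κ κ (Coord m →L[ℝ] ℝ)} {u : Coord m}
    (hθ : ∀ A B, DifferentiableAt ℝ (fun v => θ v A B) u) (A B : κ) (X Y : Coord m) :
    curvatureForm θ u A B ![X, Y] = curvMat (fun Z v => (θ v).map (· Z)) X Y u A B := by
  have hd : DifferentiableAt ℝ (fun v => oneForm (θ v A B)) u :=
    (ContinuousAlternatingMap.ofSubsingletonLIE (0 : Fin 1) :
      (Coord m →L[ℝ] ℝ) ≃ₗᵢ[ℝ] Form m 1).differentiableAt.comp u (hθ A B)
  have h1 : extDeriv (fun v => oneForm (θ v A B)) u ![X, Y]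
      = fderiv ℝ (fun v => θ v A B Y) u X - fderiv ℝ (fun v => θ v A B X) u Y := by
    rw [extDeriv_apply hd, Fin.sum_univ_two]
    simp [oneForm_apply, Fin.removeNth, sub_eq_add_neg]
  simp only [curvatureForm, Matrix.of_apply, ContinuousAlternatingMap.add_apply, h1, bracket,
    ContinuousAlternatingMap.smul_apply, ContinuousAlternatingMap.sum_apply,
    ContinuousAlternatingMap.sub_apply, Matrix.map_apply, wedge_oneForm_apply, smul_eq_mul]
  simp only [curvMat, dMat, Matrix.sub_apply, Matrix.add_apply, Matrix.mul_apply, Matrix.of_apply,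
    Matrix.map_apply]
  rw [add_sub_assoc, ← Finset.sum_sub_distrib, Finset.mul_sum]
  congr 1
  exact Finset.sum_congr rfl fun C _ => by ring

end HaGravity

/-! ### The Cartan connection: reduction of its Yang–Mills equations to a Ricci equation. -/

namespace HaGravity

variable {z : ℕ} {m : Fin (z + 1) → ℕ}

theorem extDeriv_fun_zero {r : ℕ} (u : Coord m) :
    extDeriv (fun _ : Coord m => (0 : Form m r)) u = 0 := by
  ext v
  simp [extDeriv, ContinuousAlternatingMap.alternatizeUncurryFin_apply]

namespace HaData

/-- The full Ricci trace `R_ρ{}^λ{}_{τλ}`. -/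
noncomputable def ricci (H : HaData m) (ρ τ : Idx m) (u : Coord m) : ℝ := ∑ l, H.curv ρ l τ l u

end HaData

namespace Gauge

variable {V : Type*} [TopologicalSpace V] [ChartedSpace (Coord m) V] {S : HaSpacetime m V}
  (G : Gauge S) {u : Coord m}

theorem isHa : G.H.IsHa G.chart.1.target := S.isHa G.chart

theorem isUnit_det_e (hu : u ∈ G.W) : IsUnit (G.e u).det :=
  isUnit_iff_ne_zero.2 (G.e_adapted.nondeg u hu)

theorem isUnit_det_χ (hu : u ∈ G.W) : IsUnit (G.χ u).det :=
  isUnit_iff_ne_zero.2 (G.χ_adapted.nondeg u hu)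

/-! #### The orthonormal frame -/

theorem onCoframe_onFrame (hu : u ∈ G.W) (α β : Idx m) :
    G.onCoframe u α (G.onFrame u β) = if α = β then 1 else 0 := by
  have h1 := congrFun (congrFun (Matrix.mul_nonsing_inv _ (G.isUnit_det_e hu)) α) β
  rw [Matrix.mul_apply, Matrix.one_apply] at h1
  rw [← h1]
  simp [onCoframe, onFrame, map_sum, sum_apply, G.isHa.coframe_frame (G.subset hu), mul_comm]

theorem coframe_eq_sum_onCoframe (hu : u ∈ G.W) (μ : Idx m) :
    G.H.coframe μ u = ∑ l, (G.e u)⁻¹ μ l • G.onCoframe u l := by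
  have h1 (ν : Idx m) := congrFun (congrFun (Matrix.nonsing_inv_mul _ (G.isUnit_det_e hu)) μ) ν
  simp only [Matrix.mul_apply, Matrix.one_apply] at h1
  simp only [onCoframe, Finset.smul_sum, smul_smul]
  rw [Finset.sum_comm]
  simp [← Finset.sum_smul, h1]

theorem sum_onCoframe_smul_onFrame (hu : u ∈ G.W) (v : Coord m) :
    ∑ σ, G.onCoframe u σ v • G.onFrame u σ = v := by
  conv_rhs => rw [← G.isHa.sum_coframe_smul_frame (G.subset hu) v]
  simp only [G.coframe_eq_sum_onCoframe hu, sum_apply, smul_apply, Finset.sum_smul, onFrame,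
    Finset.smul_sum, smul_smul, smul_eq_mul]
  rw [Finset.sum_comm]
  exact Finset.sum_congr rfl fun μ _ => Finset.sum_congr rfl fun σ _ => by rw [mul_comm]

theorem gInv_eq (hu : u ∈ G.W) (μ ρ : Idx m) :
    G.H.gInv μ ρ u = ∑ l, (G.e u)⁻¹ μ l * G.η l * (G.e u)⁻¹ ρ l := by
  have hη : Matrix.diagonal G.η * Matrix.diagonal G.η = 1 := by
    rw [Matrix.diagonal_mul_diagonal, ← Matrix.diagonal_one]
    congr 1
    ext1 l
    rcases G.η_sign l with h | h <;> simp [h]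
  -- Orthonormality reads `g = eᵀ η e`; it is inverted using `η² = 1`.
  have hg : G.H.metricMatrix u = (G.e u).transpose * Matrix.diagonal G.η * G.e u := by
    ext α β
    rw [Matrix.mul_apply]
    simp only [HaData.metricMatrix, Matrix.of_apply, G.orthonormal u hu, Matrix.mul_diagonal,
      Matrix.transpose_apply]
    exact Finset.sum_congr rfl fun l _ => by ring
  have hi : (G.H.metricMatrix u)⁻¹
      = (G.e u)⁻¹ * Matrix.diagonal G.η * ((G.e u)⁻¹).transpose := by
    refine Matrix.inv_eq_left_inv ?_
    have ht : ((G.e u)⁻¹).transpose * (G.e u).transpose = 1 := by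
      rw [← Matrix.transpose_mul, Matrix.mul_nonsing_inv _ (G.isUnit_det_e hu),
        Matrix.transpose_one]
    calc _ = (G.e u)⁻¹ * (Matrix.diagonal G.η * (((G.e u)⁻¹).transpose * (G.e u).transpose)
          * Matrix.diagonal G.η) * G.e u := by rw [hg]; noncomm_ring
      _ = 1 := by rw [ht, mul_one, hη, mul_one, Matrix.nonsing_inv_mul _ (G.isUnit_det_e hu)]
  rw [HaData.gInv, hi, Matrix.mul_apply]
  simp [Matrix.mul_diagonal]

/-- `*⁻¹(δu^μ ∧ *K)` is minus the contraction of `K` with the vector dual to `δu^μ`. -/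
theorem starInv_wedge_star_apply (hdim : 2 ≤ dim m) (hu : u ∈ G.W) (μ : Idx m) (K : Form m 2)
    (Y : Coord m) :
    G.starInv (dim m - 2 + 1) 1 u
        (wedge (G.H.coframe μ u) (G.star 2 (dim m - 2) u K)) (fun _ => Y)
      = -∑ ρ, G.H.gInv μ ρ u * K ![G.H.frame ρ u, Y] := by
  -- Linearity of `K` in each slot is packaged as a linear map, so that expansions in the
  -- orthonormal frame can be resummed.
  have hlin (Z : Coord m) : ∃ L : Coord m →ₗ[ℝ] ℝ, ∀ Y, L Y = K ![Z, Y] :=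
    ⟨(K.toAlternatingMap.toMultilinearMap.toLinearMap ![Z, 0] 1), fun Y => by
      simp only [MultilinearMap.toLinearMap_apply]
      change K _ = _
      congr 1
      ext1 i
      fin_cases i <;> simp⟩
  have hlin' : ∃ L : Coord m →ₗ[ℝ] ℝ, ∀ Z, L Z = K ![Z, Y] := by
    obtain ⟨L, hL⟩ := hlin Y
    exact ⟨-L, fun Z => by rw [LinearMap.neg_apply, hL, ← form_two_swap]⟩
  have h1 (l : Idx m) : G.starInv (dim m - 2 + 1) 1 u
        (wedge (G.onCoframe u l) (G.star 2 (dim m - 2) u K)) (fun _ => Y)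
      = -(G.η l * K ![G.onFrame u l, Y]) := by
    rw [starInv, star, hodgeInv_wedge_hodge (by omega) (G.onCoframe_onFrame hu) G.η_sign]
    obtain ⟨L, hL⟩ := hlin (G.onFrame u l)
    simp only [ContinuousAlternatingMap.sum_apply, ContinuousAlternatingMap.smul_apply,
      oneForm_apply, smul_eq_mul, ← hL]
    conv_rhs => rw [← G.sum_onCoframe_smul_onFrame hu Y]
    simp only [map_sum, map_smul, smul_eq_mul, Finset.mul_sum, ← Finset.sum_neg_distrib]
    exact Finset.sum_congr rfl fun σ _ => by ring
  have h2 : G.starInv (dim m - 2 + 1) 1 u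
        (wedge (G.H.coframe μ u) (G.star 2 (dim m - 2) u K))
      = ∑ l, (G.e u)⁻¹ μ l • G.starInv (dim m - 2 + 1) 1 u
        (wedge (G.onCoframe u l) (G.star 2 (dim m - 2) u K)) := by
    rw [G.coframe_eq_sum_onCoframe hu, sum_wedge]
    refine (map_sum (AddMonoidHom.mk' (G.starInv (dim m - 2 + 1) 1 u)
      (hodgeInv_add _ _ _ _ _)) _ _).trans (Finset.sum_congr rfl fun l _ => ?_)
    rw [smul_wedge]
    exact hodgeInv_smul _ _ _ _ _ _ _
  obtain ⟨L, hL⟩ := hlin'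
  rw [h2]
  simp only [ContinuousAlternatingMap.sum_apply, ContinuousAlternatingMap.smul_apply, h1, ← hL,
    smul_eq_mul, G.gInv_eq hu, onFrame, map_sum, map_smul, Finset.mul_sum, Finset.sum_mul,
    ← Finset.sum_neg_distrib]
  rw [Finset.sum_comm]
  exact Finset.sum_congr rfl fun ρ _ => Finset.sum_congr rfl fun l _ => by ring

/-! #### The curvature in the frame `χ` -/

/-- This exhibits `linConn` as the gauge transform of `connMat` by `χ`, the shape to which
`curvMat_gauge` applies. -/
theorem linConn_apply (hu : u ∈ G.W) (X : Coord m) :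
    (G.linConn u).map (· X)
      = G.χ u * G.H.connMat X u * (G.χ u)⁻¹ + G.χ u * dMat (fun v => (G.χ v)⁻¹) X u := by
  ext α β
  have h1 (φ : Idx m) := G.isHa.sum_coframe_mul_apply_frame (G.subset hu)
    (fderiv ℝ (fun v => (G.χ v)⁻¹ φ β) u) X
  simp only [Matrix.map_apply, linConn, Matrix.of_apply, sum_apply, smul_apply, smul_eq_mul,
    Matrix.add_apply, Matrix.mul_apply, dMat, HaData.connMat, ← h1, HaData.del, add_mul,
    Finset.sum_add_distrib, Finset.sum_mul, Finset.mul_sum]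
  congr 1
  · rw [Finset.sum_comm]
    simp only [Finset.sum_comm (s := (Finset.univ : Finset (Idx m))) (t := Finset.univ)
      (f := fun γ ψ => G.χ u α _ * G.H.Γ _ ψ γ u * (G.χ u)⁻¹ ψ β * G.H.coframe γ u X)]
    rw [Finset.sum_comm]
    exact Finset.sum_congr rfl fun ψ _ => Finset.sum_congr rfl fun φ _ =>
      Finset.sum_congr rfl fun γ _ => by ring
  · rw [Finset.sum_comm]
    exact Finset.sum_congr rfl fun φ _ => Finset.sum_congr rfl fun γ _ => by ring

theorem linCurv_apply (hu : u ∈ G.W) (α β : Idx m) (X Y : Coord m) :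
    G.linCurv u α β ![X, Y] = (G.χ u * curvMat G.H.connMat X Y u * (G.χ u)⁻¹) α β := by
  have hχ : MatSmoothOn G.W G.χ := G.χ_adapted.smooth
  have hχi : MatSmoothOn G.W fun v => (G.χ v)⁻¹ := hχ.inv G.χ_adapted.nondeg
  have hB (X : Coord m) : MatSmoothOn G.W (G.H.connMat X) := fun a b =>
    (G.isHa.matSmoothOn_connMat X a b).mono G.subset
  have hA (X : Coord m) : MatSmoothOn G.W fun v => (G.linConn v).map (· X) := fun a b =>
    ((((hχ.mul (hB X)).mul hχi).add (hχ.mul (hχi.dMat G.isOpen X))) a b).congr fun v hv =>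
      congrFun (congrFun (G.linConn_apply hv X) a) b
  have hd (A B : Idx m) : DifferentiableAt ℝ (fun v => G.linConn v A B) u :=
    ((contDiffOn_clm_apply.2 fun X => hA X A B).contDiffAt
      (G.isOpen.mem_nhds hu)).differentiableAt (n := ∞) (by simp)
  rw [linCurv, curvatureForm_apply hd, ← curvMat_gauge hB hχ hχi G.isOpen hu
    (fun v hv => Matrix.mul_nonsing_inv _ (G.isUnit_det_χ hv))]
  simp only [curvMat, G.linConn_apply hu]
  rw [dMat_congr (fun v hv => G.linConn_apply hv _) G.isOpen hu,
    dMat_congr (fun v hv => G.linConn_apply hv _) G.isOpen hu]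

/-! #### The Yang-Mills equations -/

/-- The zero bottom rows keep `χ` out of the linear block. In the translation column `½ [Θ, Θ]`
gives `½ (θ ∧ χ - χ ∧ θ) = θ ∧ χ`, the algebraic part of the torsion. -/
theorem cartanCurv_eq (u : Coord m) :
    G.cartanCurv u
      = Matrix.fromBlocks (G.linCurv u) (Matrix.of fun α _ => G.torsion u α) 0 0 := by
  have h0 : oneForm (0 : Coord m →L[ℝ] ℝ) = 0 := by ext v; rfl
  refine Matrix.ext fun A B => ?_
  rcases A with α | ⟨⟩ <;> rcases B with β | ⟨⟩
  · simp [cartanCurv, linCurv, curvatureForm, cartanConn, bracket, h0, wedge_zero, zero_wedge]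
  · simp only [cartanCurv, curvatureForm, cartanConn, bracket, torsion, Matrix.of_apply,
      Fintype.sum_sum_type, Matrix.map_apply, Matrix.fromBlocks_apply₁₁,
      Matrix.fromBlocks_apply₁₂, Matrix.fromBlocks_apply₂₂, Matrix.zero_apply, h0, wedge_zero,
      zero_wedge, sub_zero, Finset.sum_const_zero, add_zero]
    rw [Finset.smul_sum]
    refine congrArg (_ + ·) (Finset.sum_congr rfl fun β _ => ?_)
    rw [wedge_oneForm_swap (G.shift u β)]
    ext v
    simp only [ContinuousAlternatingMap.smul_apply, ContinuousAlternatingMap.sub_apply,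
      ContinuousAlternatingMap.neg_apply, smul_eq_mul]
    ring
  · simp [cartanCurv, curvatureForm, cartanConn, bracket, h0, wedge_zero, zero_wedge, extDeriv_fun_zero]
  · simp [cartanCurv, curvatureForm, cartanConn, bracket, h0, wedge_zero, zero_wedge, extDeriv_fun_zero]

theorem star_zero (r s : ℕ) (u : Coord m) : G.star r s u 0 = 0 := by simp [star, hodge]

theorem starInv_zero (r s : ℕ) (u : Coord m) : G.starInv r s u 0 = 0 := by
  simp [starInv, hodgeInv, hodge]

theorem starInv_sub (r s : ℕ) (u : Coord m) (β γ : Form m r) :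
    G.starInv r s u (β - γ) = G.starInv r s u β - G.starInv r s u γ :=
  map_sub (AddMonoidHom.mk' (G.starInv r s u) (hodgeInv_add _ _ _ r s)) β γ

theorem starInv_sum {J : Type*} (t : Finset J) (r s : ℕ) (u : Coord m) (β : J → Form m r) :
    G.starInv r s u (∑ j ∈ t, β j) = ∑ j ∈ t, G.starInv r s u (β j) :=
  map_sum (AddMonoidHom.mk' (G.starInv r s u) (hodgeInv_add _ _ _ r s)) β t

theorem codiff_zero (u : Coord m) : G.codiff (fun _ => 0) u = 0 := by
  simp [codiff, star_zero, extDeriv_fun_zero, starInv_zero]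

/-- The Yang-Mills operator of the Cartan connection. -/
theorem yangMillsOp_cartan (u : Coord m) :
    G.yangMillsOp G.cartanConn G.cartanCurv u
      = Matrix.fromBlocks (G.yangMillsOp G.linConn G.linCurv u)
        (Matrix.of fun α _ => G.torsionTerm u α
          - ∑ β, G.starInv (dim m - 2 + 1) 1 u
            (wedge (G.shift u β) (G.star 2 (dim m - 2) u (G.linCurv u α β)))) 0 0 := by
  rw [show G.cartanCurv = fun u => Matrix.fromBlocks (G.linCurv u)
    (Matrix.of fun α _ => G.torsion u α) 0 0 from funext G.cartanCurv_eq]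
  refine Matrix.ext fun A B => ?_
  rcases A with α | ⟨⟩ <;> rcases B with β | ⟨⟩
  · simp [yangMillsOp, cartanConn, bracket, star_zero, wedge_zero, zero_wedge]
  · simp only [yangMillsOp, cartanConn, bracket, torsionTerm, Matrix.of_apply,
      Fintype.sum_sum_type, Matrix.map_apply, Matrix.fromBlocks_apply₁₁,
      Matrix.fromBlocks_apply₁₂, Matrix.fromBlocks_apply₂₂, Matrix.zero_apply, star_zero,
      wedge_zero, zero_wedge, Finset.sum_const_zero, add_zero, Finset.sum_sub_distrib,
      add_sub_assoc, zero_sub]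
    rw [← sub_eq_add_neg, starInv_sub, starInv_sum, starInv_sum]
  · simp [yangMillsOp, cartanConn, bracket, star_zero, wedge_zero, zero_wedge, codiff_zero,
      starInv_zero]
  · simp [yangMillsOp, cartanConn, bracket, star_zero, wedge_zero, zero_wedge, codiff_zero,
      starInv_zero]

/-- This is where the Ricci tensor appears: `starInv_wedge_star_apply` contracts a form index of the
curvature with its lower frame index, and metric compatibility converts this into the Ricci
contraction with the upper index. The minus signs of the two steps cancel. -/
theorem sum_starInv_wedge_shift_apply (hdim : 2 ≤ dim m) (hu : u ∈ G.W) (α τ : Idx m) :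
    (∑ β, G.starInv (dim m - 2 + 1) 1 u
      (wedge (G.shift u β) (G.star 2 (dim m - 2) u (G.linCurv u α β))))
        (fun _ => G.H.frame τ u)
      = (G.χ u * (G.H.metricMatrix u)⁻¹ * Matrix.of fun a b => G.H.ricci a b u) α τ := by
  have h1 (β : Idx m) : G.starInv (dim m - 2 + 1) 1 u
      (wedge (G.shift u β) (G.star 2 (dim m - 2) u (G.linCurv u α β))) (fun _ => G.H.frame τ u)
      = -∑ μ, ∑ ρ, G.χ u β μ * (G.H.gInv μ ρ u
        * (G.χ u * curvMat G.H.connMat (G.H.frame ρ u) (G.H.frame τ u) u * (G.χ u)⁻¹) α β) := by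
    have hs : G.starInv (dim m - 2 + 1) 1 u
        (wedge (G.shift u β) (G.star 2 (dim m - 2) u (G.linCurv u α β)))
        = ∑ μ, G.χ u β μ • G.starInv (dim m - 2 + 1) 1 u
          (wedge (G.H.coframe μ u) (G.star 2 (dim m - 2) u (G.linCurv u α β))) := by
      rw [shift, sum_wedge, starInv_sum]
      refine Finset.sum_congr rfl fun μ _ => ?_
      rw [smul_wedge]
      exact hodgeInv_smul _ _ _ _ _ _ _
    rw [hs]
    simp only [ContinuousAlternatingMap.sum_apply, ContinuousAlternatingMap.smul_apply,
      G.starInv_wedge_star_apply hdim hu, G.linCurv_apply hu, smul_eq_mul, mul_neg,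
      Finset.sum_neg_distrib, Finset.mul_sum]
  have h2 (ρ : Idx m) : ∑ β, ∑ μ, G.χ u β μ * (G.H.gInv μ ρ u
        * (G.χ u * curvMat G.H.connMat (G.H.frame ρ u) (G.H.frame τ u) u * (G.χ u)⁻¹) α β)
      = -∑ l, (G.χ u * (G.H.metricMatrix u)⁻¹) α l * G.H.curv l ρ τ ρ u := by
    set Ω := curvMat G.H.connMat (G.H.frame ρ u) (G.H.frame τ u) u with hΩ
    have h3 : ∑ β, ∑ μ, G.χ u β μ * (G.H.gInv μ ρ u * (G.χ u * Ω * (G.χ u)⁻¹) α β)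
        = (G.χ u * Ω * (G.χ u)⁻¹ * (G.χ u * (G.H.metricMatrix u)⁻¹)) α ρ := by
      rw [Matrix.mul_apply]
      refine Finset.sum_congr rfl fun β _ => ?_
      rw [Matrix.mul_apply (M := G.χ u) (N := (G.H.metricMatrix u)⁻¹), Finset.mul_sum]
      exact Finset.sum_congr rfl fun μ _ => by rw [HaData.gInv]; ring
    -- The inner `χ⁻¹ χ` drops out, and skewness of the curvature with an index raised moves `g⁻¹`
    -- to the left of the transposed curvature.
    have h4 : G.χ u * Ω * (G.χ u)⁻¹ * (G.χ u * (G.H.metricMatrix u)⁻¹)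
        = -(G.χ u * (G.H.metricMatrix u)⁻¹ * Ω.transpose) := by
      calc _ = G.χ u * Ω * ((G.χ u)⁻¹ * G.χ u) * (G.H.metricMatrix u)⁻¹ := by noncomm_ring
        _ = G.χ u * (Ω * (G.H.metricMatrix u)⁻¹) := by
          rw [Matrix.nonsing_inv_mul _ (G.isUnit_det_χ hu), mul_one, mul_assoc]
        _ = _ := by
          rw [hΩ, G.isHa.curv_skew G.chart.1.open_target (G.subset hu), mul_neg, mul_assoc]
    rw [h3, h4, Matrix.neg_apply, Matrix.mul_apply]
    congr 1
    refine Finset.sum_congr rfl fun l _ => ?_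
    rw [Matrix.transpose_apply, hΩ, G.isHa.curvMat_frame G.chart.1.open_target (G.subset hu)]
  rw [ContinuousAlternatingMap.sum_apply]
  simp only [h1, Finset.sum_neg_distrib]
  have h5 : ∑ β, ∑ μ, ∑ ρ, G.χ u β μ * (G.H.gInv μ ρ u
        * (G.χ u * curvMat G.H.connMat (G.H.frame ρ u) (G.H.frame τ u) u * (G.χ u)⁻¹) α β)
      = ∑ ρ, -∑ l, (G.χ u * (G.H.metricMatrix u)⁻¹) α l * G.H.curv l ρ τ ρ u := by
    simp only [← h2]
    exact (Finset.sum_congr rfl fun β _ => Finset.sum_comm).trans Finset.sum_comm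
  rw [h5, Finset.sum_neg_distrib, neg_neg, Matrix.mul_apply, Finset.sum_comm]
  simp only [HaData.ricci, Matrix.of_apply, Finset.mul_sum]

theorem ricciTerm_apply (Q : Idx m → Idx m → Coord m → ℝ) (hu : u ∈ G.W) (α τ : Idx m) :
    G.ricciTerm Q u α (fun _ => G.H.frame τ u)
      = -(G.χ u * (G.H.metricMatrix u)⁻¹ * Matrix.of fun a b => Q a b u) α τ := by
  rw [ricciTerm, ContinuousAlternatingMap.neg_apply, ContinuousAlternatingMap.sum_apply]
  simp only [ContinuousAlternatingMap.smul_apply, oneForm_apply,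
    G.isHa.coframe_frame (G.subset hu), smul_eq_mul, mul_ite, mul_one, mul_zero,
    Finset.sum_ite_eq, Finset.mem_univ, if_true, Matrix.mul_apply, Matrix.of_apply,
    Finset.sum_mul, HaData.gInv]
  rw [Finset.sum_comm]

theorem form_one_ext_frame (hu : u ∈ G.W) {β γ : Form m 1}
    (h : ∀ τ, β (fun _ => G.H.frame τ u) = γ (fun _ => G.H.frame τ u)) : β = γ := by
  obtain ⟨b, rfl⟩ := (ContinuousAlternatingMap.ofSubsingleton ℝ (Coord m) ℝ (0 : Fin 1)).surjective β
  obtain ⟨c, rfl⟩ := (ContinuousAlternatingMap.ofSubsingleton ℝ (Coord m) ℝ (0 : Fin 1)).surjective γ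
  congr 1
  ext1 v
  rw [← G.isHa.sum_coframe_mul_apply_frame (G.subset hu) b,
    ← G.isHa.sum_coframe_mul_apply_frame (G.subset hu) c]
  exact Finset.sum_congr rfl fun τ _ => congrArg (· * _) (h τ)

/-- The Yang-Mills equations say that `Q` is the Ricci tensor. -/
theorem yangMills_iff (hdim : 2 ≤ dim m) (Q : Idx m → Idx m → Coord m → ℝ) :
    G.YangMills Q ↔ ∀ u ∈ G.W, ∀ a b, G.H.ricci a b u = Q a b u := by
  refine forall₂_congr fun u hu => ?_
  -- Both sides carry the left factor `χ g⁻¹`; its invertibility is what lets the equation be read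
  -- as `Ric = Q`.
  have hinv : IsUnit (G.χ u * (G.H.metricMatrix u)⁻¹) := by
    rw [Matrix.isUnit_iff_isUnit_det, Matrix.det_mul]
    exact (G.isUnit_det_χ hu).mul (Matrix.isUnit_nonsing_inv_det _
      (isUnit_iff_ne_zero.2 (G.isHa.g_nondeg u (G.subset hu))))
  have h1 : G.yangMillsOp G.cartanConn G.cartanCurv u = G.source Q u ↔
      ∀ α, -∑ β, G.starInv (dim m - 2 + 1) 1 u
            (wedge (G.shift u β) (G.star 2 (dim m - 2) u (G.linCurv u α β)))
        = G.ricciTerm Q u α := by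
    rw [yangMillsOp_cartan, source, Matrix.fromBlocks_inj]
    simp only [true_and, and_true, ← Matrix.ext_iff, Matrix.of_apply, sub_eq_add_neg,
      add_right_inj, forall_const]
  have h2 (α : Idx m) : (-∑ β, G.starInv (dim m - 2 + 1) 1 u
            (wedge (G.shift u β) (G.star 2 (dim m - 2) u (G.linCurv u α β)))
        = G.ricciTerm Q u α) ↔
      ∀ τ, (G.χ u * (G.H.metricMatrix u)⁻¹ * Matrix.of fun a b => G.H.ricci a b u) α τ
        = (G.χ u * (G.H.metricMatrix u)⁻¹ * Matrix.of fun a b => Q a b u) α τ := by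
    constructor
    · intro h τ
      have h3 := congrArg (fun β : Form m 1 => β fun _ => G.H.frame τ u) h
      simp only [ContinuousAlternatingMap.neg_apply, G.sum_starInv_wedge_shift_apply hdim hu,
        G.ricciTerm_apply Q hu] at h3
      exact neg_injective h3
    · intro h
      refine G.form_one_ext_frame hu fun τ => ?_
      rw [ContinuousAlternatingMap.neg_apply, G.sum_starInv_wedge_shift_apply hdim hu,
        G.ricciTerm_apply Q hu, h]
  rw [h1]
  simp only [h2]
  rw [Matrix.ext_iff, hinv.mul_right_inj, ← Matrix.ext_iff]
  rfl

end Gauge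

end HaGravity

namespace HaGravity

/-! ### The Einstein equations in Ricci form -/

namespace HaData

variable {z : ℕ} {m : Fin (z + 1) → ℕ} {H : HaData m} {U : Set (Coord m)} {u : Coord m}

theorem IsHa.ricci_of_horizontal (h : H.IsHa U) (hU : IsOpen U) (hu : u ∈ U) {i : Idx m}
    (hi : i.1 = 0) (τ : Idx m) : H.ricci i τ u = H.ricH i τ u := by
  rw [ricH, Finset.sum_filter_of_ne]
  · rfl
  · intro k _ hk
    by_contra hk0
    exact hk (h.curv_eq_zero hU hu (by simp [hi, hk0]) _ _)

theorem IsHa.ricci_of_vertical (h : H.IsHa U) (hU : IsOpen U) (hu : u ∈ U) {a : Idx m}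
    (ha : a.1 ≠ 0) (τ : Idx m) : H.ricci a τ u = H.ricS a τ u := by
  rw [ricS, Finset.sum_filter_of_ne]
  · rfl
  · intro k _ hk hk0
    exact hk (h.curv_eq_zero hU hu (by simp [ha, hk0]) _ _)

/-- The contraction is over the other index of the skew form pair, which accounts for the sign of
the last Einstein equation. -/
theorem IsHa.ricP2_eq (h : H.IsHa U) (hU : IsOpen U) (hu : u ∈ U) (b a : Idx m) :
    H.ricP2 b a u = -H.ricci b a u := by
  rw [ricP2, Finset.sum_filter_of_ne, ricci, ← Finset.sum_neg_distrib]
  · exact Finset.sum_congr rfl fun c _ => H.curv_swap _ _ _ _ _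
  · intro k _ hk
    by_contra hk0
    exact hk (h.curv_eq_zero hU hu hk0 _ _)

/-- The inverse metric has no mixed horizontal-vertical components. -/
theorem IsHa.gInv_eq_zero (h : H.IsHa U) (hu : u ∈ U) {α β : Idx m}
    (hαβ : ¬ (α.1 = 0 ↔ β.1 = 0)) : H.gInv α β u = 0 := by
  classical
  -- `P` is the projection onto horizontal indices. It commutes with the block diagonal `g`, hence
  -- with `g⁻¹`.
  set P : Matrix (Idx m) (Idx m) ℝ := Matrix.diagonal fun α => if α.1 = 0 then 1 else 0 with hP
  have hd : IsUnit (H.metricMatrix u).det := isUnit_iff_ne_zero.2 (h.g_nondeg u hu)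
  have hc : H.metricMatrix u * P = P * H.metricMatrix u := by
    ext a b
    rw [hP, Matrix.mul_diagonal, Matrix.diagonal_mul]
    by_cases hab : a.1 = b.1
    · rw [hab, mul_comm]
    · simp [metricMatrix, h.g_block u hu a b hab]
  have hc' : P * (H.metricMatrix u)⁻¹ = (H.metricMatrix u)⁻¹ * P := by
    calc _ = (H.metricMatrix u)⁻¹ * (H.metricMatrix u * P) * (H.metricMatrix u)⁻¹ := by
          rw [← mul_assoc, Matrix.nonsing_inv_mul _ hd, one_mul]
      _ = _ := by
          rw [hc, mul_assoc, mul_assoc, Matrix.mul_nonsing_inv _ hd, mul_one]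
  have h1 := congrFun (congrFun hc' α) β
  rw [hP, Matrix.mul_diagonal, Matrix.diagonal_mul] at h1
  rw [gInv]
  by_cases hα : α.1 = 0 <;> by_cases hβ : β.1 = 0 <;> simp_all

theorem IsHa.scalar_eq_trace (h : H.IsHa U) (hU : IsOpen U) (hu : u ∈ U) :
    H.scalarH u + H.scalarS u = H.trace H.ricci u := by
  rw [trace, ← Finset.sum_filter_add_sum_filter_not Finset.univ (fun α : Idx m => α.1 = 0)]
  congr 1
  · refine Finset.sum_congr rfl fun i hi => ?_
    have hi' : i.1 = 0 := (Finset.mem_filter.1 hi).2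
    rw [Finset.sum_filter_of_ne]
    · exact Finset.sum_congr rfl fun j _ => by rw [h.ricci_of_horizontal hU hu hi']
    · intro j _ hj
      by_contra hj0
      exact hj (by rw [h.gInv_eq_zero hu (by simp [hi', hj0]), zero_mul])
  · refine Finset.sum_congr rfl fun a ha => ?_
    have ha' : a.1 ≠ 0 := (Finset.mem_filter.1 ha).2
    rw [Finset.sum_filter_of_ne]
    · exact Finset.sum_congr rfl fun b _ => by rw [h.ricci_of_vertical hU hu ha']
    · intro b _ hb hb0
      exact hb (by rw [h.gInv_eq_zero hu (by simp [ha', hb0]), zero_mul])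

/-- The mixed equations need no scalar term because `g` vanishes between different shells. For
different vertical shells the `S` equations and the `P` equations overlap, consistently for the same
reason. -/
theorem IsHa.einsteinAt_iff (h : H.IsHa U) (hU : IsOpen U) (hu : u ∈ U)
    (Q : Idx m → Idx m → Coord m → ℝ) :
    H.EinsteinAt Q u ↔
      ∀ a b, H.ricci a b u - 1 / 2 * H.trace H.ricci u * H.g a b u = Q a b u := by
  rw [EinsteinAt, h.scalar_eq_trace hU hu]
  constructor
  · rintro ⟨hH, hS, hP1, hP2⟩ a b
    by_cases ha : a.1 = 0 <;> by_cases hb : b.1 = 0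
    · rw [h.ricci_of_horizontal hU hu ha, hH a b ha hb]
    · have h1 := hP2 b a (by rw [ha]; exact Fin.pos_of_ne_zero hb)
      rw [h.ricP2_eq hU hu, neg_inj] at h1
      rw [h1, h.g_block u hu a b (by rw [ha]; exact Ne.symm hb), mul_zero, sub_zero]
    · have h1 := hP1 a b (by rw [hb]; exact Fin.pos_of_ne_zero ha)
      rw [h.ricci_of_vertical hU hu ha, h.g_block u hu a b (by rw [hb]; exact ha), mul_zero,
        sub_zero]
      exact h1
    · rw [h.ricci_of_vertical hU hu ha, hS a b ha hb]
  · intro hE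
    refine ⟨fun i j hi _ => ?_, fun a b ha _ => ?_, fun a b hab => ?_, fun a b hab => ?_⟩
    · rw [← h.ricci_of_horizontal hU hu hi, hE]
    · rw [← h.ricci_of_vertical hU hu ha, hE]
    · have ha : a.1 ≠ 0 := (lt_of_le_of_lt (Fin.zero_le _) hab).ne'
      have h1 := hE a b
      rw [h.ricci_of_vertical hU hu ha, h.g_block u hu a b hab.ne', mul_zero, sub_zero] at h1
      exact h1
    · have h1 := hE b a
      rw [h.g_block u hu b a hab.ne, mul_zero, sub_zero] at h1
      rw [h.ricP2_eq hU hu, h1]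

theorem IsHa.sum_gInv_mul_g (h : H.IsHa U) (hu : u ∈ U) :
    ∑ α, ∑ β, H.gInv α β u * H.g α β u = (dim m : ℝ) := by
  have hd : IsUnit (H.metricMatrix u).det := isUnit_iff_ne_zero.2 (h.g_nondeg u hu)
  have h1 (α : Idx m) := congrFun (congrFun (Matrix.nonsing_inv_mul _ hd) α) α
  simp only [Matrix.mul_apply, Matrix.one_apply_eq] at h1
  calc _ = ∑ α, ∑ β, (H.metricMatrix u)⁻¹ α β * H.metricMatrix u β α :=
        Finset.sum_congr rfl fun α _ => Finset.sum_congr rfl fun β _ => by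
          rw [h.g_symm u hu α β]; rfl
    _ = _ := by rw [Finset.sum_congr rfl fun α _ => h1 α, Finset.sum_const, Finset.card_univ,
          card_idx, nsmul_eq_mul, mul_one]

theorem IsHa.trace_eq_of_eq_add (h : H.IsHa U) (hu : u ∈ U) {P Q : Idx m → Idx m → Coord m → ℝ}
    {c : ℝ} (hPQ : ∀ a b, P a b u = Q a b u + c * H.g a b u) :
    H.trace P u = H.trace Q u + c * (dim m : ℝ) := by
  rw [← h.sum_gInv_mul_g hu]
  simp only [trace, hPQ, Finset.mul_sum, ← Finset.sum_add_distrib]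
  exact Finset.sum_congr rfl fun α _ => Finset.sum_congr rfl fun β _ => by ring

/-- Trace reversal of the Einstein equations. -/
theorem IsHa.einsteinAt_iff_ricci (h : H.IsHa U) (hU : IsOpen U) (hu : u ∈ U)
    (hdim : 3 ≤ dim m) (Q : Idx m → Idx m → Coord m → ℝ) :
    H.EinsteinAt Q u ↔
      ∀ a b, H.ricci a b u = H.traceShift (1 / ((dim m : ℝ) - 2)) Q a b u := by
  have hn : (dim m : ℝ) - 2 ≠ 0 := by
    have : (3 : ℝ) ≤ (dim m : ℝ) := by exact_mod_cast hdim
    linarith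
  rw [h.einsteinAt_iff hU hu]
  constructor
  · intro hE
    have h1 := h.trace_eq_of_eq_add hu (P := H.ricci) (Q := Q)
      (c := 1 / 2 * H.trace H.ricci u) fun a b => by linarith [hE a b]
    -- The trace of the Einstein equations is `(1 - n/2) tr Ric = tr Q`, solvable since `n ≠ 2`.
    have h2 : H.trace H.ricci u = -2 * (1 / ((dim m : ℝ) - 2)) * H.trace Q u := by
      field_simp
      linarith
    intro a b
    have h3 := hE a b
    rw [h2] at h3
    rw [traceShift]
    linarith
  · intro hE
    have h1 := h.trace_eq_of_eq_add hu (P := H.ricci) (Q := Q)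
      (c := -(1 / ((dim m : ℝ) - 2) * H.trace Q u)) fun a b => by
        rw [hE a b, traceShift]; ring
    have h2 : H.trace H.ricci u = -2 * (1 / ((dim m : ℝ) - 2)) * H.trace Q u := by
      rw [h1]
      field_simp
      ring
    intro a b
    rw [h2, hE a b, traceShift]
    ring

end HaData

/-- On a region with a section, the Einstein and the Yang-Mills equations are equivalent. -/
theorem Gauge.einstein_iff_yangMills {z : ℕ} {m : Fin (z + 1) → ℕ} (hdim : 3 ≤ dim m)
    {V : Type*} [TopologicalSpace V] [ChartedSpace (Coord m) V] {S : HaSpacetime m V}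
    (G : Gauge S) (Q : Idx m → Idx m → Coord m → ℝ) :
    (∀ u ∈ G.W, G.H.EinsteinAt Q u) ↔
      G.YangMills (G.H.traceShift (1 / ((dim m : ℝ) - 2)) Q) := by
  rw [G.yangMills_iff (by omega)]
  exact forall₂_congr fun u hu =>
    G.isHa.einsteinAt_iff_ricci G.chart.1.open_target (G.subset hu) hdim Q

end HaGravity

theorem mainTheorem1 {z : ℕ} (m : Fin (z + 1) → ℕ) (hdim : 3 ≤ HaGravity.dim m)
    {V : Type*} [TopologicalSpace V] [ChartedSpace (HaGravity.Coord m) V]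
    [IsManifold 𝓘(ℝ, HaGravity.Coord m) ∞ V]
    (S : HaGravity.HaSpacetime m V) (Υ : HaGravity.DTensor S) (k lam : ℝ) :
    -- on every region with a local section of the frame bundle
    (∀ G : HaGravity.Gauge S,
      (∀ u ∈ G.W, G.H.EinsteinAt (G.E Υ k lam) u) ↔
        G.YangMills (G.H.traceShift (1 / ((HaGravity.dim m : ℝ) - 2)) (G.E Υ k lam))) ∧
    -- on the whole spacetime, for every family of local sections that covers the charts
    (∀ 𝒢 : Set (HaGravity.Gauge S),
      (∀ c : atlas (HaGravity.Coord m) V, ∀ u ∈ c.1.target, ∃ G ∈ 𝒢, G.chart = c ∧ u ∈ G.W) →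
      (S.Einstein Υ k lam ↔ ∀ G ∈ 𝒢, G.YangMills
        (G.H.traceShift (1 / ((HaGravity.dim m : ℝ) - 2)) (G.E Υ k lam)))) ∧
    -- in dimension four the coefficient is one half
    (HaGravity.dim m = 4 → ∀ G : HaGravity.Gauge S,
      (∀ u ∈ G.W, G.H.EinsteinAt (G.E Υ k lam) u) ↔
        G.YangMills (G.H.traceShift (1 / 2) (G.E Υ k lam))) := by
  refine ⟨fun G => G.einstein_iff_yangMills hdim _, fun 𝒢 hcov => ⟨fun hE G _ => ?_, ?_⟩,
    fun h4 G => ?_⟩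
  · exact (G.einstein_iff_yangMills hdim _).1 fun u hu => hE G.chart u (G.subset hu)
  · intro hY c u hu
    -- The covering region lies in the given chart itself, so no transformation law is needed to
    -- pass from local to global.
    obtain ⟨G, hG, rfl, huW⟩ := hcov c u hu
    exact (G.einstein_iff_yangMills hdim _).2 (hY G hG) u huW
  · rw [G.einstein_iff_yangMills hdim, h4]
    norm_num
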